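/- Let $s\in\mathbb N$, let $\mathcal F=\bigoplus_{n\ge 0}\mathcal F_n$ be the symmetric (bosonic) Fock space over $L^2(\mathbb R^s)$ with particle number operator $N$, and let $\gamma_u(B)=e^{iuN}Be^{-iuN}$, $u\in\mathbb R$, be the adjoint action of the gauge group $U(1)$ on the bounded operators $\mathcal B(\mathcal F)$. For $f\in\mathcal D(\mathbb R^s)$ (complex valued smooth functions of compact support) let $\phi(f)$ be the selfadjoint closure of $a^*(f)+a(f)$ on the vectors of finite particle number, and let $\mathfrak R\subset\mathcal B(\mathcal F)$ be the resolvent algebra, i.e. the norm closed *-algebra generated by the resolvents $R(\lambda,f)=(i\lambda+\phi(f))^{-1}$, $\lambda\in\mathbb R\setminus\{0\}$, $f\in\mathcal D(\mathbb R^s)$. An operator $B$ is a tensor of degree $m\in\mathbb Z$ if $\gamma_u(B)=e^{ium}B$ for all $u$. Let $\mathfrak A$ be the algebra of gauge invariant elements of $\mathfrak R$ (the observables), let $\mathfrak R_M$, $M\in\mathbb N_0$, be the norm closed linear span of the tensors in $\mathfrak R$ of degree $m$ with $|m|\le M$, and let the field algebra $\mathfrak F$ be the norm closure of $\bigcup_M\mathfrak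 R_M$. For a set $S\subset\mathcal B(\mathcal F)$ say that $B\in\mathcal B(\mathcal F)$ is locally in $S$ if for every $n\in\mathbb N_0$ there is $R\in S$ with $B\upharpoonright\bigoplus_{k=0}^n\mathcal F_k=R\upharpoonright\bigoplus_{k=0}^n\mathcal F_k$. Let $\overline{\mathfrak A}$ be the set of all bounded operators which are locally in $\mathfrak A$, and let $\overline{\mathfrak F}$ be the norm closure of the set of all bounded operators which are locally in $\mathfrak R_M$ for some $M\in\mathbb N_0$ (depending on the operator). **Lemma 3.2.** The norm closed space $\overline{\mathfrak F}$ is a (unital) C*-algebra, i.e. a norm closed *-subalgebra of $\mathcal B(\mathcal F)$. It extends the field algebra, $\mathfrak F\subset\overline{\mathfrak F}$, and contains the extended algebra of observables, $\overline{\mathfrak A}\subset\overline{\mathfrak F}$. The gauge group acts on $\overline{\mathfrak F}$ by the automorphisms $\gamma_u$, so $\gamma_u(\overline{\mathfrak F})=\overline{\mathfrak F}$, and this action is pointwise norm continuous. Harmonic analysis and synthesis hold on $\overline{\mathfrak F}$: 1. for every $F\in\overline{\mathfrak F}$ and $m\in\mathbb Z$ the harmonic $F_m=(2\pi)^{-1}\int_0^{2\pi}e^{-ium}\gamma_u(F)\,du$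 exists as a norm convergent integral, belongs to $\overline{\mathfrak F}$, and is a tensor of degree $m$; 2. if $F$ is locally in $\mathfrak R_M$, then all $F_m$ are locally in $\mathfrak R_M$, $F_m=0$ for $|m|>M$, and $F=\sum_{m=-M}^M F_m$; 3. every $F\in\overline{\mathfrak F}$ is the norm limit, as $L\to\infty$, of the Cesàro sums $\sum_{m=-L}^{L}\bigl(1-\tfrac{|m|}{L+1}\bigr)F_m$ of its harmonics; in particular it lies in the norm closed linear span of its harmonics. Moreover, $\overline{\mathfrak A}$ is the fixed point algebra of $\overline{\mathfrak F}$ under gauge transformations, $\overline{\mathfrak A}=\{F\in\overline{\mathfrak F}:\gamma_u(F)=F\text{ for all }u\}$. -/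

import Mathlib

open MeasureTheory
open scoped ENNReal ContDiff

noncomputable section

namespace BosonField

/-! ### The symmetric Fock space over `L²(ℝˢ)` -/

/-- Position space `ℝˢ`. -/
abbrev Pos (s : ℕ) : Type := EuclideanSpace ℝ (Fin s)

/-- The single particle Hilbert space `L²(ℝˢ)`. -/
abbrev OneParticle (s : ℕ) : Type := Lp ℂ 2 (volume : Measure (Pos s))

/-- The Hilbert space `L²((ℝˢ)ⁿ)` of `n` distinguishable particles, i.e. the `n`-fold Hilbert space
tensor power of `L²(ℝˢ)`. -/
abbrev Distinguishable (s n : ℕ) : Type := Lp ℂ 2 (volume : Measure (Fin n → Pos s))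

theorem measurePreserving_perm (s n : ℕ) (σ : Equiv.Perm (Fin n)) :
    MeasurePreserving (fun x : Fin n → Pos s => fun i => x (σ i)) volume volume := by
  have h := volume_measurePreserving_piCongrLeft (fun _ : Fin n => Pos s) σ.symm
  convert h using 1
  funext x i
  have := Equiv.piCongrLeft_apply_apply (fun _ : Fin n => Pos s) σ.symm x (σ i)
  simpa [MeasurableEquiv.coe_piCongrLeft] using this.symm

/-- The permutation operators, `(U_σ Ψ)(x₁, …, xₙ) = Ψ(x_{σ 1}, …, x_{σ n})`. -/
def permOp (s n : ℕ) (σ : Equiv.Perm (Fin n)) : Distinguishable s n →L[ℂ] Distinguishable s n :=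
  (Lp.compMeasurePreservingₗᵢ ℂ _ (measurePreserving_perm s n σ)).toContinuousLinearMap

/-- The `n`-particle space `𝓕ₙ`: the permutation symmetric elements of `L²((ℝˢ)ⁿ)`. -/
def nParticle (s n : ℕ) : Submodule ℂ (Distinguishable s n) :=
  ⨅ σ : Equiv.Perm (Fin n), LinearMap.ker (permOp s n σ - 1).toLinearMap

theorem isClosed_nParticle (s n : ℕ) :
    IsClosed (nParticle s n : Set (Distinguishable s n)) := by
  rw [nParticle, Submodule.coe_iInf]
  exact isClosed_iInter fun σ => (permOp s n σ - 1).isClosed_ker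

instance instCompleteSpaceNParticle (s n : ℕ) : CompleteSpace (nParticle s n) :=
  (isClosed_nParticle s n).completeSpace_coe

/-- The bosonic Fock space: the Hilbert space direct sum of the spaces `𝓕ₙ`, `n ∈ ℕ₀`. -/
def Fock (s : ℕ) : Type := lp (fun n : ℕ => nParticle s n) 2

instance instNormedAddCommGroupFock (s : ℕ) : NormedAddCommGroup (Fock s) :=
  inferInstanceAs (NormedAddCommGroup (lp (fun n : ℕ => nParticle s n) 2))

instance instInnerProductSpaceFock (s : ℕ) : InnerProductSpace ℂ (Fock s) :=
  inferInstanceAs (InnerProductSpace ℂ (lp (fun n : ℕ => nParticle s n) 2))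

instance instCompleteSpaceFock (s : ℕ) : CompleteSpace (Fock s) :=
  inferInstanceAs (CompleteSpace (lp (fun n : ℕ => nParticle s n) 2))

/-- The square summable sequence of the `n`-particle components of a Fock space vector. -/
def Fock.toLp {s : ℕ} (Ψ : Fock s) : lp (fun n : ℕ => nParticle s n) 2 := Ψ

/-- The Fock space vector with given square summable components. -/
def Fock.ofMemℓp {s : ℕ} (Ψ : (n : ℕ) → nParticle s n) (h : Memℓp Ψ 2) : Fock s :=
  (⟨Ψ, h⟩ : lp (fun n : ℕ => nParticle s n) 2)

/-- `Ψ n` is the `n`-particle component of the vector `Ψ`. -/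
instance instCoeFunFock (s : ℕ) : CoeFun (Fock s) (fun _ => (n : ℕ) → nParticle s n) :=
  ⟨fun Ψ n => Ψ.toLp n⟩

theorem Fock.ext {s : ℕ} {Ψ Φ : Fock s} (h : ∀ n, Ψ n = Φ n) : Ψ = Φ :=
  lp.ext (funext h)

@[simp] theorem Fock.zero_apply {s : ℕ} (n : ℕ) : (0 : Fock s) n = 0 := rfl

@[simp] theorem Fock.add_apply {s : ℕ} (Ψ Φ : Fock s) (n : ℕ) : (Ψ + Φ) n = Ψ n + Φ n := rfl

@[simp] theorem Fock.smul_apply {s : ℕ} (c : ℂ) (Ψ : Fock s) (n : ℕ) : (c • Ψ) n = c • Ψ n := rfl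

@[simp] theorem Fock.ofMemℓp_apply {s : ℕ} (Ψ : (n : ℕ) → nParticle s n) (h : Memℓp Ψ 2) (n : ℕ) :
    Fock.ofMemℓp Ψ h n = Ψ n := rfl

/-- The bounded operators on Fock space. -/
abbrev Op (s : ℕ) : Type := Fock s →L[ℂ] Fock s

/-- The subspace `⨁_{k ≤ n} 𝓕ₖ` of vectors of particle number at most `n`. -/
def upTo (s n : ℕ) : Submodule ℂ (Fock s) where
  carrier := {Ψ | ∀ k, n < k → Ψ k = 0}
  zero_mem' := by intro k _; simp
  add_mem' := by intro Ψ Φ hΨ hΦ k hk; simp [hΨ k hk, hΦ k hk]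
  smul_mem' := by intro c Ψ hΨ k hk; simp [hΨ k hk]

/-- The vectors of finite particle number, `⋃ₙ ⨁_{k ≤ n} 𝓕ₖ`. -/
def finiteVectors (s : ℕ) : Submodule ℂ (Fock s) where
  carrier := {Ψ | ∃ n, Ψ ∈ upTo s n}
  zero_mem' := ⟨0, zero_mem _⟩
  add_mem' := by
    rintro Ψ Φ ⟨n, hn⟩ ⟨m, hm⟩
    refine ⟨max n m, fun k hk => ?_⟩
    have h1 := hn k (lt_of_le_of_lt (le_max_left _ _) hk)
    have h2 := hm k (lt_of_le_of_lt (le_max_right _ _) hk)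
    simp [h1, h2]
  smul_mem' := by
    rintro c Ψ ⟨n, hn⟩
    exact ⟨n, (upTo s n).smul_mem c hn⟩

/-! ### Creation and annihilation operators -/

theorem eLpNorm_tensorFun {s n : ℕ} (f : OneParticle s) (Ψ : Distinguishable s n) :
    AEStronglyMeasurable (fun x : Fin (n + 1) → Pos s => f (x 0) * Ψ (fun i => x i.succ)) volume ∧
    eLpNorm (fun x : Fin (n + 1) → Pos s => f (x 0) * Ψ (fun i => x i.succ)) 2 volume
      = eLpNorm f 2 volume * eLpNorm Ψ 2 volume := by
  have hmp := volume_preserving_piFinSuccAbove (fun _ : Fin (n + 1) => Pos s) 0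
  have hf := (Lp.memLp f).aestronglyMeasurable
  have hΨ := (Lp.memLp Ψ).aestronglyMeasurable
  have hm : AEStronglyMeasurable (fun z : Pos s × (Fin n → Pos s) => f z.1 * Ψ z.2)
      ((volume : Measure (Pos s)).prod volume) := hf.comp_fst.mul hΨ.comp_snd
  have heq : (fun x : Fin (n + 1) → Pos s => f (x 0) * Ψ (fun i => x i.succ))
      = (fun z : Pos s × (Fin n → Pos s) => f z.1 * Ψ z.2) ∘
        (MeasurableEquiv.piFinSuccAbove (fun _ : Fin (n + 1) => Pos s) 0) := by
    funext x
    rfl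
  rw [heq]
  refine ⟨hm.comp_measurePreserving hmp, ?_⟩
  rw [eLpNorm_comp_measurePreserving hm hmp]
  rw [eLpNorm_eq_lintegral_rpow_enorm_toReal (by simp) (by simp),
    eLpNorm_eq_lintegral_rpow_enorm_toReal (by simp) (by simp),
    eLpNorm_eq_lintegral_rpow_enorm_toReal (by simp) (by simp)]
  simp only [enorm_mul]
  have : ∀ z : Pos s × (Fin n → Pos s),
      (‖f z.1‖ₑ * ‖Ψ z.2‖ₑ) ^ (2 : ℝ≥0∞).toReal
        = ‖f z.1‖ₑ ^ (2 : ℝ≥0∞).toReal * ‖Ψ z.2‖ₑ ^ (2 : ℝ≥0∞).toReal := fun z =>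
    ENNReal.mul_rpow_of_nonneg _ _ (by simp)
  simp only [this]
  rw [lintegral_prod_mul (hf.enorm.pow_const _) (hΨ.enorm.pow_const _),
    ENNReal.mul_rpow_of_nonneg _ _ (by simp)]

theorem memLp_tensorFun {s n : ℕ} (f : OneParticle s) (Ψ : Distinguishable s n) :
    MemLp (fun x : Fin (n + 1) → Pos s => f (x 0) * Ψ (fun i => x i.succ)) 2 volume := by
  refine ⟨(eLpNorm_tensorFun f Ψ).1, ?_⟩
  rw [(eLpNorm_tensorFun f Ψ).2]
  exact ENNReal.mul_lt_top (Lp.memLp f).2 (Lp.memLp Ψ).2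

theorem quasiMeasurePreserving_tail (s n : ℕ) :
    Measure.QuasiMeasurePreserving
      (fun x : Fin (n + 1) → Pos s => fun i : Fin n => x i.succ) volume volume :=
  Measure.quasiMeasurePreserving_snd.comp
    (volume_preserving_piFinSuccAbove (fun _ : Fin (n + 1) => Pos s) 0).quasiMeasurePreserving

/-- The map `Ψ ↦ f ⊗ Ψ`, where `(f ⊗ Ψ)(x₀, …, xₙ) = f(x₀) Ψ(x₁, …, xₙ)`. -/
def tensorLeft {s : ℕ} (f : OneParticle s) (n : ℕ) :
    Distinguishable s n →L[ℂ] Distinguishable s (n + 1) :=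
  LinearMap.mkContinuous
    { toFun := fun Ψ => (memLp_tensorFun f Ψ).toLp
      map_add' := by
        intro Ψ Φ
        rw [← MemLp.toLp_add]
        refine MemLp.toLp_congr _ _ ?_
        filter_upwards [(quasiMeasurePreserving_tail s n).ae (Lp.coeFn_add Ψ Φ)] with x hx
        simp only [Pi.add_apply] at hx ⊢
        rw [hx, mul_add]
      map_smul' := by
        intro c Ψ
        rw [RingHom.id_apply, ← MemLp.toLp_const_smul]
        refine MemLp.toLp_congr _ _ ?_
        filter_upwards [(quasiMeasurePreserving_tail s n).ae (Lp.coeFn_smul c Ψ)] with x hx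
        simp only [Pi.smul_apply, smul_eq_mul] at hx ⊢
        rw [hx]
        ring }
    ‖f‖ (by
      intro Ψ
      simp only [LinearMap.coe_mk, AddHom.coe_mk]
      rw [Lp.norm_toLp, (eLpNorm_tensorFun f Ψ).2, ENNReal.toReal_mul, Lp.norm_def, Lp.norm_def])

/-- The creation operator `a*(f) : 𝓕ₙ → 𝓕ₙ₊₁`, `a*(f) Ψ = √(n+1) P₊ (f ⊗ Ψ)`, where `P₊` is the
orthogonal projection onto the symmetric subspace. -/
def creation {s : ℕ} (f : OneParticle s) (n : ℕ) : nParticle s n →L[ℂ] nParticle s (n + 1) :=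
  ((Real.sqrt (n + 1) : ℝ) : ℂ) •
    ((nParticle s (n + 1)).orthogonalProjectionOnto ∘L tensorLeft f n ∘L (nParticle s n).subtypeL)

/-- The annihilation operator `a(f) : 𝓕ₙ₊₁ → 𝓕ₙ`, the hermitean conjugate of `a*(f)`. -/
def annihilation {s : ℕ} (f : OneParticle s) (n : ℕ) :
    nParticle s (n + 1) →L[ℂ] nParticle s n :=
  ContinuousLinearMap.adjoint (creation f n)

/-! ### The field operators and their resolvents -/

/-- The components of `(a*(f) + a(f)) Ψ`. -/
def fieldFun {s : ℕ} (f : OneParticle s) (Ψ : Fock s) : (n : ℕ) → nParticle s n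
  | 0 => annihilation f 0 (Ψ 1)
  | n + 1 => creation f n (Ψ n) + annihilation f (n + 1) (Ψ (n + 2))

theorem memℓp_fieldFun {s : ℕ} (f : OneParticle s) {Ψ : Fock s} (h : Ψ ∈ finiteVectors s) :
    Memℓp (fieldFun f Ψ) 2 := by
  obtain ⟨n, hn⟩ := h
  refine (memℓp_zero ?_).of_exponent_ge (zero_le (a := (2 : ℝ≥0∞)))
  refine (Set.finite_le_nat (n + 1)).subset fun k hk => ?_
  by_contra hlt
  simp only [Set.mem_ofPred_eq, not_le] at hlt hk
  obtain ⟨j, rfl⟩ : ∃ j, k = j + 1 := ⟨k - 1, by omega⟩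
  refine hk ?_
  simp [fieldFun, hn j (by omega), hn (j + 2) (by omega)]

/-- The field operator `φ₀(f) = a*(f) + a(f)` on the domain of vectors of finite particle number. -/
def fieldOp {s : ℕ} (f : OneParticle s) : Fock s →ₗ.[ℂ] Fock s where
  domain := finiteVectors s
  toFun :=
    { toFun := fun Ψ => Fock.ofMemℓp (fieldFun f Ψ) (memℓp_fieldFun f Ψ.2)
      map_add' := by
        intro Ψ Φ
        refine Fock.ext fun k => ?_
        cases k with
        | zero => simp [fieldFun]
        | succ k =>
          simp only [Fock.ofMemℓp_apply, Fock.add_apply, fieldFun, Submodule.coe_add, map_add]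
          abel
      map_smul' := by
        intro c Ψ
        refine Fock.ext fun k => ?_
        cases k with
        | zero => simp [fieldFun]
        | succ k => simp [fieldFun] }

/-- `f ∈ 𝓓(ℝˢ) ⊂ L²(ℝˢ)`: the class `f` has a smooth, compactly supported representative. -/
def IsTest {s : ℕ} (f : OneParticle s) : Prop :=
  ∃ g : Pos s → ℂ, ContDiff ℝ ∞ g ∧ HasCompactSupport g ∧ f =ᵐ[volume] g

/-- `R = (iλ + φ(f))⁻¹`, where the selfadjoint operator `φ(f)` is the closure of `φ₀(f)`:
the bounded operator `R` is the two-sided inverse of `iλ + φ(f)`. -/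
def IsResolvent {s : ℕ} (lam : ℝ) (f : OneParticle s) (R : Op s) : Prop :=
  ∀ Ψ Φ : Fock s, R Ψ = Φ ↔ ∃ h : Φ ∈ (fieldOp f).closure.domain,
    (Complex.I * (lam : ℂ)) • Φ + (fieldOp f).closure ⟨Φ, h⟩ = Ψ

/-- The resolvent algebra `𝕽`: the norm closed *-algebra of operators on Fock space generated by the
resolvents `R(λ, f)`, `λ ∈ ℝ ∖ {0}`, `f ∈ 𝓓(ℝˢ)`. -/
def resolventAlgebra (s : ℕ) : NonUnitalStarSubalgebra ℂ (Op s) :=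
  (NonUnitalStarAlgebra.adjoin ℂ
    {R : Op s | ∃ (lam : ℝ) (f : OneParticle s),
      lam ≠ 0 ∧ IsTest f ∧ IsResolvent lam f R}).topologicalClosure

/-! ### The gauge group -/

theorem memℓp_phase {s : ℕ} (z : Circle) (Ψ : Fock s) :
    Memℓp (fun n => ((z : ℂ) ^ n • Ψ n : nParticle s n)) 2 := by
  refine memℓp_gen ?_
  have h := (memℓp_gen_iff (p := 2) (by simp)).1 (lp.memℓp Ψ.toLp)
  simpa [norm_smul, Circle.norm_coe] using h

/-- For `z = e^{iu}` this is the operator `e^{iuN}`, where `N` is the particle number operator: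
it acts as multiplication by `zⁿ = e^{iun}` on `𝓕ₙ`. -/
def phase {s : ℕ} (z : Circle) : Fock s →ₗ[ℂ] Fock s where
  toFun := fun Ψ => Fock.ofMemℓp (fun n => (z : ℂ) ^ n • Ψ n) (memℓp_phase z Ψ)
  map_add' := by
    intro Ψ Φ
    refine Fock.ext fun n => ?_
    simp
  map_smul' := by
    intro c Ψ
    refine Fock.ext fun n => ?_
    simp [smul_comm c]

theorem phase_apply {s : ℕ} (z : Circle) (Ψ : Fock s) (n : ℕ) :
    phase z Ψ n = (z : ℂ) ^ n • Ψ n := rfl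

theorem phase_one {s : ℕ} (Ψ : Fock s) : phase 1 Ψ = Ψ := by
  refine Fock.ext fun n => ?_
  simp [phase_apply]

theorem phase_mul {s : ℕ} (z w : Circle) (Ψ : Fock s) :
    phase (z * w) Ψ = phase z (phase w Ψ) := by
  refine Fock.ext fun n => ?_
  simp [phase_apply, mul_pow, mul_smul]

theorem norm_phase {s : ℕ} (z : Circle) (Ψ : Fock s) : ‖phase z Ψ‖ = ‖Ψ‖ := by
  change ‖(phase z Ψ).toLp‖ = ‖Ψ.toLp‖
  rw [lp.norm_eq_tsum_rpow (by simp), lp.norm_eq_tsum_rpow (by simp)]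
  congr 2
  funext n
  change ‖(z : ℂ) ^ n • Ψ n‖ ^ _ = ‖Ψ n‖ ^ _
  simp [norm_smul, Circle.norm_coe]

/-- The unitary representation `e^{iu} ↦ e^{iuN}` of the gauge group `U(1)` on Fock space. -/
def gaugeUnitary (s : ℕ) : Circle →* unitary (Op s) :=
  (Unitary.linearIsometryEquiv (𝕜 := ℂ) (H := Fock s)).symm.toMonoidHom.comp
    { toFun := fun z =>
        { phase z with
          norm_map' := norm_phase z
          invFun := phase z⁻¹
          left_inv := fun Ψ => (phase_mul z⁻¹ z Ψ).symm.trans (by rw [inv_mul_cancel, phase_one])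
          right_inv := fun Ψ =>
            (phase_mul z z⁻¹ Ψ).symm.trans (by rw [mul_inv_cancel, phase_one]) }
      map_one' := LinearIsometryEquiv.ext phase_one
      map_mul' := fun z w => LinearIsometryEquiv.ext (phase_mul z w) }

theorem gaugeUnitary_apply {s : ℕ} (z : Circle) (Ψ : Fock s) (n : ℕ) :
    (gaugeUnitary s z : Op s) Ψ n = (z : ℂ) ^ n • Ψ n := rfl

/-- The adjoint action of the gauge group on the bounded operators,
`γ_u(B) = e^{iuN} B e^{-iuN}`, as a group of *-automorphisms. -/
def gauge (s : ℕ) : Circle →* (Op s ≃⋆ₐ[ℂ] Op s) :=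
  (Unitary.conjStarAlgAut ℂ (Op s)).comp (gaugeUnitary s)

/-- The `m`-th harmonic `B_m = (2π)⁻¹ ∫₀^{2π} e^{-ium} e^{iuN} B e^{-iuN} du` of an operator `B`
(a norm convergent integral whenever `u ↦ e^{iuN} B e^{-iuN}` is norm continuous). -/
def harmonic {s : ℕ} (m : ℤ) (B : Op s) : Op s :=
  ((2 * Real.pi : ℝ) : ℂ)⁻¹ • ∫ u in (0 : ℝ)..(2 * Real.pi),
    Complex.exp (-(Complex.I * u * m)) • gauge s (Circle.exp u) B

/-! ### Tensors, observables and fields -/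

/-- `B` transforms under gauge transformations as a tensor of degree `m`:
`γ_u(B) = e^{ium} B` for all `u`. -/
def IsTensor {s : ℕ} (m : ℤ) (B : Op s) : Prop :=
  ∀ z : Circle, gauge s z B = (z : ℂ) ^ m • B

/-- The algebra of observables `𝕬`: the gauge invariant elements of the resolvent algebra. -/
def observables (s : ℕ) : Set (Op s) :=
  {A | A ∈ resolventAlgebra s ∧ ∀ z : Circle, gauge s z A = A}

/-- The space `𝕽_M`: the norm closed subspace generated by the tensors in `𝕽` of degree `m`,
`-M ≤ m ≤ M`. -/
def tensorSpace (s M : ℕ) : Submodule ℂ (Op s) :=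
  (Submodule.span ℂ
    {R : Op s | R ∈ resolventAlgebra s ∧ ∃ m : ℤ, |m| ≤ (M : ℤ) ∧ IsTensor m R}).topologicalClosure

/-- The field algebra `𝕱`: the norm closure of `⋃_M 𝕽_M`. -/
def fieldAlgebra (s : ℕ) : Set (Op s) :=
  closure (⋃ M : ℕ, (tensorSpace s M : Set (Op s)))

/-- The restriction of `B` to `⨁_{k ≤ n} 𝓕ₖ` belongs, for every `n`, to the restrictions of the
elements of `S` to `⨁_{k ≤ n} 𝓕ₖ`. -/
def LocallyIn {s : ℕ} (S : Set (Op s)) (B : Op s) : Prop :=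
  ∀ n : ℕ, ∃ R ∈ S, ∀ Ψ ∈ upTo s n, B Ψ = R Ψ

/-- The extended algebra of observables: the bounded operators which agree locally with elements
of `𝕬`. -/
def extendedObservables (s : ℕ) : Set (Op s) :=
  {A | LocallyIn (observables s) A}

/-- The bounded operators which agree locally with elements of `𝕽_M`. -/
def localFields (s M : ℕ) : Set (Op s) :=
  {F | LocallyIn (tensorSpace s M : Set (Op s)) F}

/-- The extended field algebra: the norm closure of the set of bounded operators which, for some
`M`, agree locally with elements of `𝕽_M`. -/
def extendedFieldAlgebra (s : ℕ) : Set (Op s) :=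
  closure (⋃ M : ℕ, localFields s M)

end BosonField

end

open BosonField

open scoped InnerProductSpace

/-! A tensor of degree `m` maps `k`-particle vectors to `(k + m)`-particle vectors, so elements of
`𝕽_M` raise the particle number by at most `M`, and so do their adjoints. This makes local agreement
compatible with products and adjoints, provided the operators are matched up to a larger particle
number.

Degrees in `[-M, M]` are separated by a weighted mean over the roots of unity of order `2M + 1`
(`bandProjection`). Unlike the gauge integral, this finite mean is a bounded map on all of `B(𝓕)`,
needs no continuity of orbits and respects agreement on `upTo s n`. It therefore splits every
operator locally in `𝕽_M` into finitely many tensors. Norm continuity of the gauge orbits follows,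
and extends to the closure because gauge transformations are isometric. The harmonics then coincide
with the band projections on the dense set, and being contractive they pass to limits. The Cesàro
means are contractive because the Fejér kernel is nonnegative with mean one, so their convergence on
the dense set suffices.

A gauge invariant `F` is its own zeroth harmonic, hence a limit of elements of the extended
observables. The remaining point is that these are norm closed: restricting `𝕬` to `upTo s n` is a
*-homomorphism of a C*-algebra, and such maps have closed range
(`isClosed_range_of_nonUnitalStarAlgHom`). -/

namespace BosonField

/-! ### Vectors of finite particle number and the action of gauge transformations -/

variable {s : ℕ}

/-- The vector of `𝓕` with the only nonzero component `x ∈ 𝓕ₖ`. -/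
noncomputable def Fock.single (k : ℕ) (x : nParticle s k) : Fock s :=
  (lp.single (E := fun n : ℕ => nParticle s n) 2 k x : lp (fun n : ℕ => nParticle s n) 2)

theorem Fock.single_apply_self (k : ℕ) (x : nParticle s k) : Fock.single k x k = x :=
  lp.single_apply_self (E := fun n : ℕ => nParticle s n) 2 k x

theorem Fock.single_apply_ne (k : ℕ) (x : nParticle s k) {j : ℕ} (h : j ≠ k) :
    Fock.single k x j = 0 :=
  lp.single_apply_ne (E := fun n : ℕ => nParticle s n) 2 k x h

theorem Fock.hasSum_single (Ψ : Fock s) : HasSum (fun k => Fock.single k (Ψ k)) Ψ :=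
  lp.hasSum_single (E := fun n : ℕ => nParticle s n) (p := 2) (by simp) Ψ

theorem Fock.single_mem_upTo (k : ℕ) (x : nParticle s k) : Fock.single k x ∈ upTo s k :=
  fun _ hj => Fock.single_apply_ne k x hj.ne'

theorem Fock.eq_sum_single {n : ℕ} {Ψ : Fock s} (h : Ψ ∈ upTo s n) :
    Ψ = ∑ k ∈ Finset.range (n + 1), Fock.single k (Ψ k) := by
  refine (Fock.hasSum_single Ψ).unique (hasSum_sum_of_ne_finset_zero fun k hk => ?_)
  rw [h k (by simpa using hk)]
  refine Fock.ext fun j => ?_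
  by_cases hj : j = k
  · subst hj; exact Fock.single_apply_self j 0
  · exact Fock.single_apply_ne k 0 hj

theorem dense_finiteVectors : Dense (finiteVectors s : Set (Fock s)) := by
  intro Ψ
  refine mem_closure_of_tendsto (Fock.hasSum_single Ψ) (Filter.Eventually.of_forall fun t => ?_)
  exact Submodule.sum_mem _ fun k _ => ⟨k, Fock.single_mem_upTo k _⟩

/-- Vectors of finite particle number are dense, so identities verified locally become identities of
operators. -/
theorem op_ext_upTo {A B : Op s} (h : ∀ n, ∀ Ψ ∈ upTo s n, A Ψ = B Ψ) : A = B := by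
  refine ContinuousLinearMap.ext fun Ψ => congrFun (Continuous.ext_on dense_finiteVectors A.continuous
    B.continuous ?_) Ψ
  rintro Ψ ⟨n, hn⟩
  exact h n Ψ hn

theorem gauge_apply (z : Circle) (B : Op s) (Ψ : Fock s) :
    gauge s z B Ψ = phase z (B (phase z⁻¹ Ψ)) := by
  have h : gauge s z B = gaugeUnitary s z * B * star (gaugeUnitary s z : Op s) :=
    Unitary.conjStarAlgAut_apply _ _
  have h' : star (gaugeUnitary s z : Op s) = (gaugeUnitary s z⁻¹ : Op s) := by
    rw [map_inv, ← Unitary.star_eq_inv, Unitary.coe_star]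
  rw [h, h']
  rfl

theorem phase_mem_upTo {n : ℕ} (z : Circle) {Ψ : Fock s} (h : Ψ ∈ upTo s n) :
    phase z Ψ ∈ upTo s n := fun k hk => by rw [phase_apply, h k hk, smul_zero]

theorem phase_single (z : Circle) (k : ℕ) (x : nParticle s k) :
    phase z (Fock.single k x) = (z : ℂ) ^ k • Fock.single k x := by
  refine Fock.ext fun j => ?_
  rw [phase_apply, Fock.smul_apply]
  by_cases hj : j = k
  · rw [hj]
  · rw [Fock.single_apply_ne k x hj, smul_zero, smul_zero]

theorem gauge_congr_upTo {n : ℕ} (z : Circle) {A B : Op s} (h : ∀ Ψ ∈ upTo s n, A Ψ = B Ψ) :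
    ∀ Ψ ∈ upTo s n, gauge s z A Ψ = gauge s z B Ψ := by
  intro Ψ hΨ
  rw [gauge_apply, gauge_apply, h _ (phase_mem_upTo _ hΨ)]

instance : StarHomClass (Op s ≃⋆ₐ[ℂ] Op s) (Op s) (Op s) := ⟨fun f a => f.map_star' a⟩

theorem norm_gauge (z : Circle) (B : Op s) : ‖gauge s z B‖ = ‖B‖ :=
  StarAlgEquiv.norm_map (A := Op s) (B := Op s) (gauge s z) B

theorem isometry_gauge (z : Circle) : Isometry (gauge s z) :=
  AddMonoidHomClass.isometry_of_norm _ (norm_gauge z)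

theorem gauge_inv_apply (z : Circle) (B : Op s) : gauge s z (gauge s z⁻¹ B) = B := by
  have : gauge s z (gauge s z⁻¹ B) = (gauge s z * gauge s z⁻¹) B := rfl
  rw [this, ← map_mul, mul_inv_cancel, map_one]
  rfl

/-! ### Tensors -/

/-- The space of tensors of degree `m`. -/
def tensors (s : ℕ) (m : ℤ) : Submodule ℂ (Op s) where
  carrier := {B | IsTensor m B}
  zero_mem' := fun z => by simp
  add_mem' := fun hA hB z => by rw [map_add, hA z, hB z, smul_add]
  smul_mem' := fun c B hB z => by rw [map_smul, hB z, smul_comm]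

theorem isClosed_tensors (m : ℤ) : IsClosed (tensors s m : Set (Op s)) := by
  have : (tensors s m : Set (Op s)) = ⋂ z : Circle, {B | gauge s z B = (z : ℂ) ^ m • B} := by
    ext B
    simp only [Set.mem_iInter]
    rfl
  rw [this]
  exact isClosed_iInter fun z =>
    isClosed_eq (isometry_gauge z).continuous (continuous_const_smul _)

theorem IsTensor.mul {m k : ℤ} {A B : Op s} (hA : IsTensor m A) (hB : IsTensor k B) :
    IsTensor (m + k) (A * B) := fun z => by
  rw [map_mul, hA z, hB z, smul_mul_smul_comm, zpow_add₀ z.coe_ne_zero]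

theorem IsTensor.star {m : ℤ} {A : Op s} (hA : IsTensor m A) : IsTensor (-m) (star A) := fun z => by
  rw [map_star (R := Op s) (S := Op s) (gauge s z) A, hA z, star_smul, Complex.star_def, map_zpow₀, ← Circle.coe_inv_eq_conj,
    Circle.coe_inv, inv_zpow, zpow_neg]

theorem isTensor_one : IsTensor 0 (1 : Op s) := fun z => by simp

theorem isTensor_zero_iff {A : Op s} : IsTensor 0 A ↔ ∀ z : Circle, gauge s z A = A := by
  simp [IsTensor]

theorem exists_circle_zpow_ne {j : ℤ} (h : j ≠ 0) : ∃ z : Circle, (z : ℂ) ^ j ≠ 1 := by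
  -- The `j`-th power of this point is `-1`.
  refine ⟨Circle.exp (Real.pi / j), ?_⟩
  have hj : (j : ℂ) ≠ 0 := by exact_mod_cast h
  rw [Circle.coe_exp, ← Complex.exp_int_mul]
  have : (j : ℂ) * (((Real.pi / j : ℝ) : ℂ) * Complex.I) = Real.pi * Complex.I := by
    push_cast
    field_simp
  rw [this, Complex.exp_pi_mul_I]
  norm_num

/-- On the image of a `k`-particle vector the number operator takes the value `m + k`: a component
of particle number `l ≠ m + k` would acquire two different phases, hence vanishes. -/
theorem IsTensor.apply_mem_upTo {m : ℤ} {M n : ℕ} {A : Op s} (hA : IsTensor m A) (hm : m ≤ M)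
    {Ψ : Fock s} (hΨ : Ψ ∈ upTo s n) : A Ψ ∈ upTo s (n + M) := by
  rw [Fock.eq_sum_single hΨ, map_sum]
  refine Submodule.sum_mem _ fun k hk l hl => ?_
  rw [Finset.mem_range] at hk
  have hne : (l : ℤ) - (m + k) ≠ 0 := by omega
  obtain ⟨z, hz⟩ := exists_circle_zpow_ne hne
  set x := Ψ k
  have h1 : phase z (A (Fock.single k x)) = (z : ℂ) ^ (m + k) • A (Fock.single k x) := by
    -- Evaluating covariance at the rotated vector cancels the inner `phase z⁻¹`.
    have h2 := congrArg (fun B : Op s => B (phase z (Fock.single k x))) (hA z)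
    simp only [gauge_apply, ← phase_mul, inv_mul_cancel, phase_one] at h2
    rw [h2, smul_apply, phase_single, map_smul, smul_smul,
      zpow_add₀ z.coe_ne_zero, zpow_natCast]
  have h3 : (z : ℂ) ^ l • (A (Fock.single k x)) l = (z : ℂ) ^ (m + k) • (A (Fock.single k x)) l := by
    rw [← phase_apply, h1, Fock.smul_apply]
  by_contra h0
  have h4 := smul_left_injective ℂ h0 h3
  refine hz ?_
  rw [zpow_sub₀ z.coe_ne_zero, zpow_natCast, h4, div_self (zpow_ne_zero _ z.coe_ne_zero)]

end BosonField

/-! ### Ranges of *-homomorphisms of C*-algebras -/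

open scoped ComplexStarModule in
/-- A *-homomorphism of C*-algebras maps onto a norm closed subalgebra. -/
theorem isClosed_range_of_nonUnitalStarAlgHom {A B : Type*} [NonUnitalCStarAlgebra A]
    [NonUnitalCStarAlgebra B] (φ : A →⋆ₙₐ[ℂ] B) : IsClosed (Set.range φ) := by
  have hφ : Continuous φ := AddMonoidHomClass.continuous_of_bound φ 1 fun a => by
    simpa using NonUnitalStarAlgHom.norm_apply_le φ a
  -- Truncating `a` to `[-r, r]` by functional calculus leaves its image unchanged, since the
  -- spectrum of `φ a` already lies there. The truncation vanishes at `0`, as the non-unital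
  -- calculus requires.
  have lift_sa : ∀ a : A, IsSelfAdjoint a → ∃ b, φ b = φ a ∧ ‖b‖ ≤ ‖φ a‖ := by
    intro a ha
    set r := ‖φ a‖
    have hr : 0 ≤ r := norm_nonneg _
    have hf : Continuous fun x : ℝ => max (-r) (min r x) := by fun_prop
    have h0 : max (-r) (min r 0) = 0 := by simp [hr]
    refine ⟨cfcₙ (fun x : ℝ => max (-r) (min r x)) a, ?_, ?_⟩
    · rw [NonUnitalStarAlgHomClass.map_cfcₙ (S := ℂ) φ _ a hf.continuousOn h0
        hφ ha (ha.map φ)]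
      conv_rhs => rw [← cfcₙ_id ℝ (φ a) (ha.map φ)]
      refine cfcₙ_congr fun x hx => ?_
      have hx : |x| ≤ r := by
        have := NonUnitalIsometricContinuousFunctionalCalculus.norm_quasispectrum_le (φ a) hx (ha.map φ)
        simpa using this
      rw [abs_le] at hx
      simp [hx.1, hx.2]
    · refine norm_cfcₙ_le fun x _ => ?_
      rw [Real.norm_eq_abs, abs_le]
      exact ⟨le_max_left _ _, max_le (by linarith) (min_le_left _ _)⟩
  -- Real and imaginary parts are lifted separately, whence the factor 2.
  have lift : ∀ a : A, ∃ b, φ b = φ a ∧ ‖b‖ ≤ 2 * ‖φ a‖ := by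
    intro a
    obtain ⟨b, hb, hb'⟩ := lift_sa (ℜ a) (ℜ a).2
    obtain ⟨c, hc, hc'⟩ := lift_sa (ℑ a) (ℑ a).2
    have h1 : φ (ℜ a : A) = (ℜ (φ a) : B) := by
      rw [realPart_apply_coe, realPart_apply_coe, ← Complex.coe_smul, ← Complex.coe_smul, map_smul,
        map_add, map_star]
    have h2 : φ (ℑ a : A) = (ℑ (φ a) : B) := by
      rw [imaginaryPart_apply_coe, imaginaryPart_apply_coe]
      simp [← map_star, ← map_sub, ← Complex.coe_smul, map_smul]
    refine ⟨b + Complex.I • c, ?_, ?_⟩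
    · rw [map_add, map_smul, hb, hc, ← map_smul, ← map_add, realPart_add_I_smul_imaginaryPart]
    · refine (norm_add_le _ _).trans ?_
      rw [norm_smul, Complex.norm_I, one_mul, two_mul]
      refine add_le_add (hb'.trans ?_) (hc'.trans ?_)
      · rw [h1]; exact realPart.norm_le (φ a)
      · rw [h2]; exact imaginaryPart.norm_le (φ a)
  let f : NormedAddGroupHom A B :=
    { toFun := φ
      map_add' := map_add φ
      bound' := ⟨1, fun a => by simpa using NonUnitalStarAlgHom.norm_apply_le φ a⟩ }
  have hsurj : f.SurjectiveOnWith f.range 2 := by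
    rintro _ ⟨a, rfl⟩
    exact lift a
  -- Lifting with a uniform norm bound lets a limit of the range be lifted by a convergent series in
  -- the complete space `A`.
  have hcl := controlled_closure_of_complete two_pos one_pos hsurj
  refine isClosed_of_closure_subset fun b hb => ?_
  obtain ⟨a, ha, _⟩ := hcl b hb
  exact ⟨a, ha⟩

namespace BosonField

variable {s : ℕ}

/-! ### Band projections -/

/-- The action of a gauge transformation as a bounded linear map. -/
noncomputable def gaugeL (s : ℕ) (z : Circle) : Op s →L[ℂ] Op s where
  toFun := gauge s z
  map_add' := map_add _
  map_smul' := map_smul _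
  cont := (isometry_gauge z).continuous

theorem gaugeL_apply (z : Circle) (B : Op s) : gaugeL s z B = gauge s z B := rfl

/-- The primitive root of unity `e^{2πi/(2M+1)}`. -/
noncomputable def bandRoot (M : ℕ) : Circle := Circle.exp (2 * Real.pi / (2 * M + 1 : ℕ))

theorem isPrimitiveRoot_bandRoot (M : ℕ) : IsPrimitiveRoot (bandRoot M : ℂ) (2 * M + 1) := by
  convert Complex.isPrimitiveRoot_exp (2 * M + 1) (by omega) using 1
  rw [bandRoot, Circle.coe_exp]
  congr 1
  push_cast
  ring

/-- The mean over the group of roots of unity of order `2M + 1` which, on sums of tensors of degrees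
between `-M` and `M`, projects to the part of degree `m`. -/
noncomputable def bandProjection (s M : ℕ) (m : ℤ) : Op s →L[ℂ] Op s :=
  ((2 * M + 1 : ℕ) : ℂ)⁻¹ • ∑ j ∈ Finset.range (2 * M + 1),
    (((bandRoot M ^ j : Circle) : ℂ) ^ (-m)) • gaugeL s (bandRoot M ^ j)

theorem bandProjection_apply (M : ℕ) (m : ℤ) (B : Op s) :
    bandProjection s M m B = ((2 * M + 1 : ℕ) : ℂ)⁻¹ • ∑ j ∈ Finset.range (2 * M + 1),
      (((bandRoot M ^ j : Circle) : ℂ) ^ (-m)) • gauge s (bandRoot M ^ j) B := by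
  simp [bandProjection, gaugeL_apply]

/-- Orthogonality of the characters of the cyclic group of order `2M + 1`: since `|k - m| ≤ 2M`, the
two degrees are congruent only if they are equal. -/
theorem IsTensor.bandProjection_eq {M : ℕ} {m k : ℤ} (hm : |m| ≤ M) (hk : |k| ≤ M) {B : Op s}
    (hB : IsTensor k B) : bandProjection s M m B = if m = k then B else 0 := by
  have h0 : ((2 * M + 1 : ℕ) : ℂ) ≠ 0 := by exact_mod_cast (by omega : 2 * M + 1 ≠ 0)
  have hsum : bandProjection s M m B = (((2 * M + 1 : ℕ) : ℂ)⁻¹ *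
      ∑ j ∈ Finset.range (2 * M + 1), ((bandRoot M : ℂ) ^ (k - m)) ^ j) • B := by
    rw [bandProjection_apply, mul_smul, Finset.sum_smul]
    congr 1
    refine Finset.sum_congr rfl fun j _ => ?_
    rw [hB, smul_smul, ← zpow_add₀ (Circle.coe_ne_zero _), neg_add_eq_sub, Circle.coe_pow,
      ← zpow_natCast, ← zpow_natCast, ← zpow_mul, ← zpow_mul, mul_comm]
  rw [hsum]
  split_ifs with h
  · subst h
    simp only [sub_self, zpow_zero, one_pow, Finset.sum_const, Finset.card_range, nsmul_eq_mul,
      mul_one]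
    rw [inv_mul_cancel₀ h0, one_smul]
  · have hne : (bandRoot M : ℂ) ^ (k - m) ≠ 1 := by
      rw [Ne, (isPrimitiveRoot_bandRoot M).zpow_eq_one_iff_dvd]
      intro hd
      rw [abs_le] at hm hk
      have := Int.eq_zero_of_abs_lt_dvd hd (by rw [abs_lt]; push_cast; omega)
      omega
    have hpow : ((bandRoot M : ℂ) ^ (k - m)) ^ (2 * M + 1) = 1 := by
      rw [← zpow_natCast, ← zpow_mul, mul_comm, zpow_mul, zpow_natCast,
        (isPrimitiveRoot_bandRoot M).pow_eq_one, one_zpow]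
    rw [geom_sum_eq hne, hpow, sub_self, zero_div, mul_zero, zero_smul]

theorem bandProjection_congr_upTo {n : ℕ} (M : ℕ) (m : ℤ) {A B : Op s}
    (h : ∀ Ψ ∈ upTo s n, A Ψ = B Ψ) :
    ∀ Ψ ∈ upTo s n, bandProjection s M m A Ψ = bandProjection s M m B Ψ := by
  intro Ψ hΨ
  simp only [bandProjection_apply, smul_apply, sum_apply]
  refine congrArg _ (Finset.sum_congr rfl fun j _ => ?_)
  rw [gauge_congr_upTo _ h Ψ hΨ]

/-! ### The tensors in the resolvent algebra -/

/-- The tensors of degree `m` in the resolvent algebra. -/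
noncomputable def fieldTensors (s : ℕ) (m : ℤ) : Submodule ℂ (Op s) :=
  (resolventAlgebra s).toSubmodule ⊓ tensors s m

theorem isClosed_resolventAlgebra : IsClosed (resolventAlgebra s : Set (Op s)) :=
  NonUnitalStarSubalgebra.isClosed_topologicalClosure _

theorem isClosed_fieldTensors (m : ℤ) : IsClosed (fieldTensors s m : Set (Op s)) :=
  isClosed_resolventAlgebra.inter (isClosed_tensors m)

theorem fieldTensors_le_tensorSpace {M : ℕ} {m : ℤ} (hm : |m| ≤ M) :
    fieldTensors s m ≤ tensorSpace s M := fun _ hB =>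
  Submodule.le_topologicalClosure _ (Submodule.subset_span ⟨hB.1, m, hm, hB.2⟩)

theorem isClosed_tensorSpace (M : ℕ) : IsClosed (tensorSpace s M : Set (Op s)) :=
  Submodule.isClosed_topologicalClosure _

theorem tensorSpace_le_of_isClosed {M : ℕ} {V : Submodule ℂ (Op s)} (hV : IsClosed (V : Set (Op s)))
    (h : ∀ m : ℤ, |m| ≤ M → fieldTensors s m ≤ V) : tensorSpace s M ≤ V :=
  Submodule.topologicalClosure_minimal _
    (Submodule.span_le.2 fun B hB => by
      obtain ⟨hB, m, hm, hB'⟩ := hB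
      exact h m hm ⟨hB, hB'⟩) hV

theorem bandProjection_mem_fieldTensors {M : ℕ} {m : ℤ} (hm : |m| ≤ M) {R : Op s}
    (hR : R ∈ tensorSpace s M) : bandProjection s M m R ∈ fieldTensors s m := by
  refine tensorSpace_le_of_isClosed
    (V := (fieldTensors s m).comap (bandProjection s M m).toLinearMap)
    ((isClosed_fieldTensors m).preimage (bandProjection s M m).continuous) (fun k hk B hB => ?_) hR
  change bandProjection s M m B ∈ fieldTensors s m
  rw [hB.2.bandProjection_eq hm hk]
  split_ifs with h
  · exact h ▸ hB
  · exact zero_mem _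

theorem sum_bandProjection_of_mem_tensorSpace {M : ℕ} {R : Op s} (hR : R ∈ tensorSpace s M) :
    ∑ m ∈ Finset.Icc (-(M : ℤ)) M, bandProjection s M m R = R := by
  set T : Op s →L[ℂ] Op s := ∑ m ∈ Finset.Icc (-(M : ℤ)) M, bandProjection s M m
  have hT : ∀ B, T B = ∑ m ∈ Finset.Icc (-(M : ℤ)) M, bandProjection s M m B := fun B => by
    simp [T]
  have h := tensorSpace_le_of_isClosed (M := M)
    (V := LinearMap.ker (T - ContinuousLinearMap.id ℂ (Op s)).toLinearMap)
    (T - ContinuousLinearMap.id ℂ (Op s)).isClosed_ker (fun k hk B hB => ?_) hR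
  · rw [← hT]
    exact sub_eq_zero.1 h
  · refine sub_eq_zero.2 ?_
    change T B = B
    rw [hT, Finset.sum_congr rfl fun m hm => hB.2.bandProjection_eq
      (abs_le.2 (Finset.mem_Icc.1 hm)) hk, Finset.sum_ite_eq', if_pos]
    exact Finset.mem_Icc.2 (abs_le.1 hk)

/-- The closure in the definition of `𝕽_M` adds nothing to finite sums of tensors, because the band
projections are continuous and the spaces of tensors are closed. -/
theorem exists_eq_sum_of_mem_tensorSpace {M : ℕ} {R : Op s} (hR : R ∈ tensorSpace s M) :
    ∃ T : ℤ → Op s, (∀ m : ℤ, |m| ≤ M → T m ∈ fieldTensors s m) ∧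
      R = ∑ m ∈ Finset.Icc (-(M : ℤ)) M, T m :=
  ⟨fun m => bandProjection s M m R, fun _ hm => bandProjection_mem_fieldTensors hm hR,
    (sum_bandProjection_of_mem_tensorSpace hR).symm⟩

theorem tensorSpace_mono {M N : ℕ} (h : M ≤ N) : tensorSpace s M ≤ tensorSpace s N :=
  tensorSpace_le_of_isClosed (isClosed_tensorSpace N) fun _ hm =>
    fieldTensors_le_tensorSpace (hm.trans (by exact_mod_cast h))

theorem mul_mem_tensorSpace {M N : ℕ} {A B : Op s} (hA : A ∈ tensorSpace s M)
    (hB : B ∈ tensorSpace s N) : A * B ∈ tensorSpace s (M + N) := by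
  obtain ⟨T, hT, rfl⟩ := exists_eq_sum_of_mem_tensorSpace hA
  obtain ⟨T', hT', rfl⟩ := exists_eq_sum_of_mem_tensorSpace hB
  rw [Finset.sum_mul_sum]
  refine Submodule.sum_mem _ fun m hm => Submodule.sum_mem _ fun k hk => ?_
  have hm := abs_le.2 (Finset.mem_Icc.1 hm)
  have hk := abs_le.2 (Finset.mem_Icc.1 hk)
  exact fieldTensors_le_tensorSpace (m := m + k)
    ((abs_add_le m k).trans (by push_cast; exact add_le_add hm hk))
    ⟨(resolventAlgebra s).mul_mem (hT m hm).1 (hT' k hk).1, (hT m hm).2.mul (hT' k hk).2⟩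

theorem star_mem_tensorSpace {M : ℕ} {A : Op s} (hA : A ∈ tensorSpace s M) :
    star A ∈ tensorSpace s M := by
  obtain ⟨T, hT, rfl⟩ := exists_eq_sum_of_mem_tensorSpace hA
  rw [star_sum]
  refine Submodule.sum_mem _ fun m hm => ?_
  have hm := abs_le.2 (Finset.mem_Icc.1 hm)
  exact fieldTensors_le_tensorSpace (m := -m) (by rwa [abs_neg])
    ⟨(resolventAlgebra s).star_mem' (hT m hm).1, (hT m hm).2.star⟩

theorem gauge_mem_tensorSpace {M : ℕ} (z : Circle) {A : Op s} (hA : A ∈ tensorSpace s M) :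
    gauge s z A ∈ tensorSpace s M := by
  obtain ⟨T, hT, rfl⟩ := exists_eq_sum_of_mem_tensorSpace hA
  rw [map_sum]
  refine Submodule.sum_mem _ fun m hm => ?_
  have hm := abs_le.2 (Finset.mem_Icc.1 hm)
  rw [(hT m hm).2]
  exact Submodule.smul_mem _ _ (fieldTensors_le_tensorSpace hm (hT m hm))

theorem apply_mem_upTo_of_mem_tensorSpace {M n : ℕ} {A : Op s} (hA : A ∈ tensorSpace s M)
    {Ψ : Fock s} (hΨ : Ψ ∈ upTo s n) : A Ψ ∈ upTo s (n + M) := by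
  obtain ⟨T, hT, rfl⟩ := exists_eq_sum_of_mem_tensorSpace hA
  rw [sum_apply]
  refine Submodule.sum_mem _ fun m hm => ?_
  have hm := abs_le.2 (Finset.mem_Icc.1 hm)
  exact (hT m hm).2.apply_mem_upTo (abs_le.1 hm).2 hΨ

/-! ### The resolvent algebra is unital -/

theorem fieldOp_zero_apply (Ψ : (fieldOp (0 : OneParticle s)).domain) :
    fieldOp (0 : OneParticle s) Ψ = 0 := by
  have hc : ∀ n, creation (0 : OneParticle s) n = 0 := fun n => by
    have : tensorLeft (0 : OneParticle s) n = 0 := by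
      refine ContinuousLinearMap.ext fun Φ => norm_le_zero_iff.1 ?_
      refine (LinearMap.mkContinuous_norm_le _ (norm_nonneg _) _ |> fun h =>
        ContinuousLinearMap.le_of_opNorm_le _ h Φ).trans ?_
      simp
    refine ContinuousLinearMap.ext fun x => ?_
    change ((Real.sqrt (n + 1) : ℝ) : ℂ) • (nParticle s (n + 1)).orthogonalProjectionOnto (tensorLeft 0 n x) = 0
    rw [this, zero_apply, map_zero, smul_zero]
  have ha : ∀ n, annihilation (0 : OneParticle s) n = 0 := fun n => by
    rw [annihilation, hc]
    exact LinearIsometryEquiv.map_zero _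
  refine Fock.ext fun n => ?_
  change fieldFun 0 Ψ.1 n = 0
  cases n <;> simp [fieldFun, hc, ha]

/-- The field of the zero test function closes to the zero operator, so `R(1, 0)` is a multiple of
the identity. -/
theorem one_mem_resolventAlgebra : (1 : Op s) ∈ resolventAlgebra s := by
  set φ := fieldOp (0 : OneParticle s)
  -- A closed extension of `φ`, which shows that `φ` is closable; without that, `closure` would by
  -- default return `φ` itself.
  let Z : Fock s →ₗ.[ℂ] Fock s := ⟨⊤, 0⟩
  have hZgraph : (Z.graph : Set (Fock s × Fock s)) = {p | p.2 = 0} := by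
    ext ⟨x, y⟩
    simp [Z, LinearPMap.mem_graph_iff, eq_comm]
  have hZ : Z.IsClosed := by
    rw [LinearPMap.IsClosed, hZgraph]
    exact isClosed_eq continuous_snd continuous_const
  have hle : φ ≤ Z := ⟨le_top, fun x y _ => fieldOp_zero_apply x⟩
  have hclosable : φ.IsClosable := hZ.isClosable.leIsClosable hle
  have hmem : ∀ Φ : Fock s, (Φ, (0 : Fock s)) ∈ φ.closure.graph := fun Φ => by
    rw [← hclosable.graph_closure_eq_closure_graph]
    have hmaps : Set.MapsTo (fun Ψ : Fock s => (Ψ, (0 : Fock s))) (finiteVectors s)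
        (φ.graph : Set (Fock s × Fock s)) := fun Ψ hΨ =>
      (LinearPMap.mem_graph_iff _).2 ⟨⟨Ψ, hΨ⟩, rfl, fieldOp_zero_apply _⟩
    exact hmaps.closure (by fun_prop) (dense_finiteVectors Φ)
  have hres : IsResolvent 1 (0 : OneParticle s) ((Complex.I : ℂ)⁻¹ • (1 : Op s)) := by
    intro Ψ Φ
    obtain ⟨x, hx, hx0⟩ := (LinearPMap.mem_graph_iff _).1 (hmem Φ)
    have hdom : Φ ∈ φ.closure.domain := by
      have := x.2
      rwa [hx] at this
    have hval : φ.closure ⟨Φ, hdom⟩ = 0 := by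
      exact (congrArg _ (Subtype.ext hx.symm)).trans hx0
    have hiff : ((Complex.I : ℂ)⁻¹ • (1 : Op s)) Ψ = Φ ↔ Complex.I • Φ = Ψ := by
      change (Complex.I : ℂ)⁻¹ • Ψ = Φ ↔ _
      rw [inv_smul_eq_iff₀ Complex.I_ne_zero, eq_comm]
    rw [hiff]
    constructor
    · intro h
      refine ⟨hdom, ?_⟩
      rw [hval, add_zero, Complex.ofReal_one, mul_one, h]
    · rintro ⟨h, h'⟩
      rwa [hval, add_zero, Complex.ofReal_one, mul_one] at h'
  have htest : IsTest (0 : OneParticle s) :=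
    ⟨0, contDiff_const, HasCompactSupport.zero, Lp.coeFn_zero _ _ _⟩
  have hmem' : (Complex.I : ℂ)⁻¹ • (1 : Op s) ∈ resolventAlgebra s :=
    NonUnitalStarSubalgebra.le_topologicalClosure _
      (NonUnitalStarAlgebra.subset_adjoin ℂ _ ⟨1, 0, one_ne_zero, htest, hres⟩)
  have h := (resolventAlgebra s).smul_mem' Complex.I hmem'
  change Complex.I • ((Complex.I : ℂ)⁻¹ • (1 : Op s)) ∈ resolventAlgebra s at h
  rwa [smul_smul, mul_inv_cancel₀ Complex.I_ne_zero, one_smul] at h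

/-! ### Operators which agree locally with fields -/

theorem locallyIn_of_mem {S : Set (Op s)} {B : Op s} (hB : B ∈ S) : LocallyIn S B :=
  fun _ => ⟨B, hB, fun _ _ => rfl⟩

theorem LocallyIn.mono {S T : Set (Op s)} (h : S ⊆ T) {B : Op s} (hB : LocallyIn S B) :
    LocallyIn T B := fun n => (hB n).imp fun _ hR => ⟨h hR.1, hR.2⟩

theorem observables_subset_tensorSpace : observables s ⊆ tensorSpace s 0 := fun _ hA =>
  fieldTensors_le_tensorSpace (m := 0) (by simp) ⟨hA.1, isTensor_zero_iff.2 hA.2⟩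

theorem tensorSpace_subset_localFields (M : ℕ) : (tensorSpace s M : Set (Op s)) ⊆ localFields s M :=
  fun _ hB => locallyIn_of_mem hB

theorem extendedObservables_subset_localFields : extendedObservables s ⊆ localFields s 0 :=
  fun _ hA => LocallyIn.mono observables_subset_tensorSpace hA

theorem localFields_mono {M N : ℕ} (h : M ≤ N) : localFields s M ⊆ localFields s N :=
  fun _ hA => LocallyIn.mono (tensorSpace_mono h) hA

theorem localFields_subset_extendedFieldAlgebra (M : ℕ) :
    localFields s M ⊆ extendedFieldAlgebra s :=
  (Set.subset_iUnion (fun M => localFields s M) M).trans subset_closure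

theorem zero_mem_localFields (M : ℕ) : (0 : Op s) ∈ localFields s M :=
  tensorSpace_subset_localFields M (zero_mem _)

theorem add_mem_localFields {M : ℕ} {A B : Op s} (hA : A ∈ localFields s M)
    (hB : B ∈ localFields s M) : A + B ∈ localFields s M := fun n => by
  obtain ⟨R, hR, h⟩ := hA n
  obtain ⟨R', hR', h'⟩ := hB n
  exact ⟨R + R', add_mem hR hR', fun Ψ hΨ => by simp only [add_apply, h Ψ hΨ, h' Ψ hΨ]⟩

theorem mul_mem_localFields {M N : ℕ} {A B : Op s} (hA : A ∈ localFields s M)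
    (hB : B ∈ localFields s N) : A * B ∈ localFields s (M + N) := fun n => by
  -- The right factor adds up to `N` particles before `A` acts.
  obtain ⟨R, hR, h⟩ := hA (n + N)
  obtain ⟨R', hR', h'⟩ := hB n
  refine ⟨R * R', mul_mem_tensorSpace hR hR', fun Ψ hΨ => ?_⟩
  change A (B Ψ) = R (R' Ψ)
  rw [h' Ψ hΨ, h _ (apply_mem_upTo_of_mem_tensorSpace hR' hΨ)]

theorem gauge_mem_localFields {M : ℕ} (z : Circle) {A : Op s} (hA : A ∈ localFields s M) :
    gauge s z A ∈ localFields s M := fun n => by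
  obtain ⟨R, hR, h⟩ := hA n
  exact ⟨gauge s z R, gauge_mem_tensorSpace z hR, gauge_congr_upTo z h⟩

theorem bandProjection_mem_localFields {M : ℕ} {m : ℤ} (hm : |m| ≤ M) {F : Op s}
    (hF : F ∈ localFields s M) : bandProjection s M m F ∈ localFields s M := fun n => by
  obtain ⟨R, hR, h⟩ := hF n
  exact ⟨bandProjection s M m R, fieldTensors_le_tensorSpace hm (bandProjection_mem_fieldTensors hm hR),
    bandProjection_congr_upTo M m h⟩

/-- Up to each particle number the projection agrees with that of an element of `𝕽_M`, which is a
tensor, and covariance can be tested there. -/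
theorem isTensor_bandProjection {M : ℕ} {m : ℤ} (hm : |m| ≤ M) {F : Op s}
    (hF : F ∈ localFields s M) : IsTensor m (bandProjection s M m F) := fun z => by
  refine op_ext_upTo fun n Ψ hΨ => ?_
  obtain ⟨R, hR, h⟩ := hF n
  have hR' := bandProjection_congr_upTo M m h
  rw [gauge_congr_upTo z hR' Ψ hΨ, (bandProjection_mem_fieldTensors hm hR).2 z, smul_apply,
    smul_apply, hR' Ψ hΨ]

theorem sum_bandProjection_of_mem_localFields {M : ℕ} {F : Op s} (hF : F ∈ localFields s M) :
    ∑ m ∈ Finset.Icc (-(M : ℤ)) M, bandProjection s M m F = F := by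
  refine op_ext_upTo fun n Ψ hΨ => ?_
  obtain ⟨R, hR, h⟩ := hF n
  rw [h Ψ hΨ, ← congrArg (fun B : Op s => B Ψ) (sum_bandProjection_of_mem_tensorSpace hR), sum_apply,
    sum_apply]
  exact Finset.sum_congr rfl fun m _ => bandProjection_congr_upTo M m h Ψ hΨ

theorem bandProjection_zero_mem_extendedObservables {M : ℕ} {F : Op s} (hF : F ∈ localFields s M) :
    bandProjection s M 0 F ∈ extendedObservables s := fun n => by
  obtain ⟨R, hR, h⟩ := hF n
  have hR' := bandProjection_mem_fieldTensors (m := 0) (by simp) hR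
  exact ⟨bandProjection s M 0 R, ⟨hR'.1, isTensor_zero_iff.1 hR'.2⟩, bandProjection_congr_upTo M 0 h⟩

theorem gauge_of_mem_extendedObservables {A : Op s} (hA : A ∈ extendedObservables s) (z : Circle) :
    gauge s z A = A := by
  refine op_ext_upTo fun n Ψ hΨ => ?_
  obtain ⟨R, hR, h⟩ := hA n
  rw [gauge_congr_upTo z h Ψ hΨ, hR.2 z, h Ψ hΨ]

/-- Agreement of `F` and `R` on a subspace only controls matrix elements of the adjoints against
vectors of that subspace. Here this is enough: the tensor decomposition of `F` puts `star F Ψ - star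
R Ψ` into `upTo s (n + M)`, where `F` and `R` agree, so this difference is orthogonal to itself. -/
theorem star_mem_localFields {M : ℕ} {F : Op s} (hF : F ∈ localFields s M) :
    star F ∈ localFields s M := fun n => by
  obtain ⟨R, hR, h⟩ := hF (n + M)
  refine ⟨star R, star_mem_tensorSpace hR, fun Ψ hΨ => ?_⟩
  have hF' : star F Ψ ∈ upTo s (n + M) := by
    rw [← sum_bandProjection_of_mem_localFields hF, star_sum, sum_apply]
    refine Submodule.sum_mem _ fun m hm => ?_
    have hm := abs_le.2 (Finset.mem_Icc.1 hm)
    exact (isTensor_bandProjection hm hF).star.apply_mem_upTo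
      (neg_le.1 (abs_le.1 hm).1) hΨ
  have hD := sub_mem hF' (apply_mem_upTo_of_mem_tensorSpace (star_mem_tensorSpace hR) hΨ)
  have hinner : ∀ (A : Op s) (Φ : Fock s), ⟪star A Ψ, Φ⟫_ℂ = ⟪Ψ, A Φ⟫_ℂ := fun A Φ =>
    ContinuousLinearMap.adjoint_inner_left A Φ Ψ
  rw [← sub_eq_zero, ← inner_self_eq_zero (𝕜 := ℂ), inner_sub_left, hinner, hinner, h _ hD, sub_self]

/-- The operators which agree locally with fields of some bounded tensor degree. -/
noncomputable def localFieldAlgebra (s : ℕ) : StarSubalgebra ℂ (Op s) where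
  carrier := ⋃ M : ℕ, localFields s M
  mul_mem' := by
    simp only [Set.mem_iUnion]
    rintro A B ⟨M, hA⟩ ⟨N, hB⟩
    exact ⟨M + N, mul_mem_localFields hA hB⟩
  add_mem' := by
    simp only [Set.mem_iUnion]
    rintro A B ⟨M, hA⟩ ⟨N, hB⟩
    exact ⟨max M N, add_mem_localFields (localFields_mono (le_max_left _ _) hA)
      (localFields_mono (le_max_right _ _) hB)⟩
  algebraMap_mem' := fun c => Set.mem_iUnion.2 ⟨0, tensorSpace_subset_localFields 0 (by
    rw [Algebra.algebraMap_eq_smul_one]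
    exact Submodule.smul_mem _ _ (fieldTensors_le_tensorSpace (m := 0) (by simp)
      ⟨one_mem_resolventAlgebra, isTensor_one⟩))⟩
  star_mem' := by
    simp only [Set.mem_iUnion]
    rintro A ⟨M, hA⟩
    exact ⟨M, star_mem_localFields hA⟩

/-! ### The extended algebra of observables is norm closed -/

theorem isClosed_upTo (n : ℕ) : IsClosed (upTo s n : Set (Fock s)) := by
  have : (upTo s n : Set (Fock s)) = ⋂ k, ⋂ (_ : n < k), {Ψ | Ψ k = 0} := by
    ext Ψ
    simp only [Set.mem_iInter]
    rfl
  rw [this]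
  refine isClosed_iInter fun k => isClosed_iInter fun _ => isClosed_eq ?_ continuous_const
  exact (lp.evalCLM ℂ (fun n : ℕ => nParticle s n) (2 : ENNReal) k).continuous

instance (n : ℕ) : (upTo s n).HasOrthogonalProjection :=
  haveI : CompleteSpace (upTo s n) := (isClosed_upTo n).completeSpace_coe
  inferInstance

/-- The orthogonal projection onto the vectors of particle number at most `n`. -/
noncomputable def cutoff (s n : ℕ) : Op s := (upTo s n).starProjection

theorem cutoff_apply_mem (n : ℕ) (Ψ : Fock s) : cutoff s n Ψ ∈ upTo s n :=
  (upTo s n).starProjection_apply_mem Ψ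

theorem cutoff_apply_of_mem {n : ℕ} {Ψ : Fock s} (h : Ψ ∈ upTo s n) : cutoff s n Ψ = Ψ :=
  Submodule.starProjection_eq_self_iff.2 h

theorem star_cutoff (n : ℕ) : star (cutoff s n) = cutoff s n :=
  isSelfAdjoint_starProjection _

theorem mul_cutoff_eq_iff {n : ℕ} {A B : Op s} :
    A * cutoff s n = B * cutoff s n ↔ ∀ Ψ ∈ upTo s n, A Ψ = B Ψ := by
  constructor
  · intro h Ψ hΨ
    have := congrArg (fun C : Op s => C Ψ) h
    change A (cutoff s n Ψ) = B (cutoff s n Ψ) at this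
    rwa [cutoff_apply_of_mem hΨ] at this
  · exact fun h => ContinuousLinearMap.ext fun Ψ => h _ (cutoff_apply_mem n Ψ)

theorem cutoff_mul_mul_cutoff {n : ℕ} {A : Op s} (hA : IsTensor 0 A) :
    cutoff s n * (A * cutoff s n) = A * cutoff s n :=
  ContinuousLinearMap.ext fun Ψ => cutoff_apply_of_mem
    (hA.apply_mem_upTo (M := 0) le_rfl (cutoff_apply_mem n Ψ))

/-- Both `A` and its adjoint preserve the particle number bound. This makes restriction by `cutoff`
a *-homomorphism on the observables. -/
theorem cutoff_comm {n : ℕ} {A : Op s} (hA : IsTensor 0 A) :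
    cutoff s n * A = A * cutoff s n := by
  have hA' : IsTensor 0 (star A) := by simpa using hA.star
  have h := congrArg star (cutoff_mul_mul_cutoff (n := n) hA')
  rw [star_mul, star_mul, star_star, star_cutoff, mul_assoc, cutoff_mul_mul_cutoff hA] at h
  exact h.symm

/-- The observables as a *-subalgebra. -/
noncomputable def observableAlgebra (s : ℕ) : NonUnitalStarSubalgebra ℂ (Op s) where
  carrier := observables s
  zero_mem' := (fieldTensors s 0).zero_mem |> fun h => ⟨h.1, isTensor_zero_iff.1 h.2⟩
  add_mem' := fun hA hB =>
    ⟨(resolventAlgebra s).add_mem' hA.1 hB.1, fun z => by rw [map_add, hA.2, hB.2]⟩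
  mul_mem' := fun hA hB =>
    ⟨(resolventAlgebra s).mul_mem' hA.1 hB.1, fun z => by rw [map_mul, hA.2, hB.2]⟩
  smul_mem' := fun c _ hA =>
    ⟨(resolventAlgebra s).smul_mem' c hA.1, fun z => by rw [map_smul, hA.2]⟩
  star_mem' := fun hA => ⟨(resolventAlgebra s).star_mem' hA.1, fun z => by
    rw [map_star (R := Op s) (S := Op s), hA.2]⟩

theorem isClosed_observableAlgebra : IsClosed (observableAlgebra s : Set (Op s)) := by
  convert isClosed_fieldTensors (s := s) 0 using 1
  ext A
  exact and_congr_right fun _ => isTensor_zero_iff.symm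

theorem isTensor_of_mem_observableAlgebra (A : observableAlgebra s) : IsTensor 0 (A : Op s) :=
  isTensor_zero_iff.2 A.2.2

/-- The restriction of the observables to the vectors of particle number at most `n`. -/
noncomputable def restrictObservables (s n : ℕ) : observableAlgebra s →⋆ₙₐ[ℂ] Op s where
  toFun A := A * cutoff s n
  map_smul' c A := smul_mul_assoc c (A : Op s) _
  map_zero' := zero_mul _
  map_add' A B := add_mul (A : Op s) B _
  map_mul' A B := by
    change (A : Op s) * B * cutoff s n = A * cutoff s n * (B * cutoff s n)
    rw [mul_assoc, mul_assoc, cutoff_mul_mul_cutoff (isTensor_of_mem_observableAlgebra B)]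
  map_star' A := by
    change star (A : Op s) * cutoff s n = star ((A : Op s) * cutoff s n)
    rw [← cutoff_comm (isTensor_of_mem_observableAlgebra A), star_mul, star_cutoff]

/-- For each `n` the restriction of a limit lies in the closure of the restrictions of `𝕬`, which is
already closed. -/
theorem isClosed_extendedObservables : IsClosed (extendedObservables s) := by
  -- Closedness supplies the C*-algebra structure on the domain of the restriction map.
  have : IsClosed (observableAlgebra s : Set (Op s)) := isClosed_observableAlgebra
  refine isClosed_of_closure_subset fun F hF n => ?_
  have hmaps : Set.MapsTo (fun A : Op s => A * cutoff s n) (extendedObservables s)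
      (Set.range (restrictObservables s n)) := fun A hA => by
    obtain ⟨R, hR, h⟩ := hA n
    exact ⟨⟨R, hR⟩, (mul_cutoff_eq_iff.2 h).symm⟩
  obtain ⟨R, hR⟩ := (isClosed_range_of_nonUnitalStarAlgHom (restrictObservables s n)).closure_subset
    (hmaps.closure (by fun_prop) hF)
  exact ⟨R, R.2, mul_cutoff_eq_iff.1 hR.symm⟩

/-! ### Gauge transformations of the extended field algebra -/

theorem gauge_mem_extendedFieldAlgebra (z : Circle) {F : Op s} (hF : F ∈ extendedFieldAlgebra s) :
    gauge s z F ∈ extendedFieldAlgebra s := by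
  have hmaps : Set.MapsTo (gauge s z) (⋃ M : ℕ, localFields s M) (⋃ M : ℕ, localFields s M) := by
    intro A hA
    obtain ⟨M, hA⟩ := Set.mem_iUnion.1 hA
    exact Set.mem_iUnion.2 ⟨M, gauge_mem_localFields z hA⟩
  exact hmaps.closure (isometry_gauge z).continuous hF

theorem image_gauge_extendedFieldAlgebra (z : Circle) :
    gauge s z '' extendedFieldAlgebra s = extendedFieldAlgebra s := by
  refine Set.Subset.antisymm ?_ fun F hF => ?_
  · rintro _ ⟨F, hF, rfl⟩
    exact gauge_mem_extendedFieldAlgebra z hF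
  · exact ⟨gauge s z⁻¹ F, gauge_mem_extendedFieldAlgebra z⁻¹ hF, gauge_inv_apply z F⟩

theorem IsTensor.continuous_orbit {m : ℤ} {B : Op s} (hB : IsTensor m B) :
    Continuous fun z : Circle => gauge s z B := by
  simp only [hB _]
  exact ((by fun_prop : Continuous fun z : Circle => (z : ℂ)).zpow₀ m fun z => Or.inl z.coe_ne_zero).smul continuous_const

theorem continuous_orbit_of_mem_localFields {M : ℕ} {F : Op s} (hF : F ∈ localFields s M) :
    Continuous fun z : Circle => gauge s z F := by
  rw [← sum_bandProjection_of_mem_localFields hF]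
  simp only [map_sum]
  exact continuous_finsetSum _ fun m hm =>
    (isTensor_bandProjection (abs_le.2 (Finset.mem_Icc.1 hm)) hF).continuous_orbit

/-- Isometry of the gauge action turns norm approximation into uniform approximation of orbits. -/
theorem continuous_orbit_of_mem_extendedFieldAlgebra {F : Op s} (hF : F ∈ extendedFieldAlgebra s) :
    Continuous fun z : Circle => gauge s z F := by
  have hclosed : IsClosed {F : Op s | Continuous fun z : Circle => gauge s z F} := by
    refine isClosed_of_closure_subset fun F hF => ?_
    refine continuous_of_uniform_approx_of_continuous fun u hu => ?_
    obtain ⟨ε, hε, hu⟩ := Metric.mem_uniformity_dist.1 hu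
    obtain ⟨G, hG, hFG⟩ := Metric.mem_closure_iff.1 hF ε hε
    exact ⟨_, hG, fun z => hu (by rwa [(isometry_gauge z).dist_eq])⟩
  refine closure_minimal (Set.iUnion_subset fun M F hF => ?_) hclosed hF
  exact continuous_orbit_of_mem_localFields hF

end BosonField

/-! ### The Fejér kernel -/

theorem Finset.sum_Icc_neg_succ {E : Type*} [AddCommMonoid E] (f : ℤ → E) (n : ℕ) :
    ∑ m ∈ Finset.Icc (-((n + 1 : ℕ) : ℤ)) (n + 1 : ℕ), f m =
      f (n + 1) + (f (-(n + 1)) + ∑ m ∈ Finset.Icc (-(n : ℤ)) n, f m) := by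
  have h : Finset.Icc (-((n + 1 : ℕ) : ℤ)) (n + 1 : ℕ) =
      insert ((n : ℤ) + 1) (insert (-((n : ℤ) + 1)) (Finset.Icc (-(n : ℤ)) n)) := by
    ext m
    simp only [Finset.mem_Icc, Finset.mem_insert]
    omega
  rw [h, Finset.sum_insert, Finset.sum_insert]
  · simp
  · simp only [Finset.mem_Icc, Finset.mem_insert]
    omega

theorem pow_succ_mul_sum_inv_pow {w : ℂ} (hw : w ≠ 0) (n : ℕ) :
    w ^ (n + 1) * ∑ k ∈ Finset.range (n + 1), w⁻¹ ^ k = ∑ k ∈ Finset.range (n + 1), w ^ (k + 1) := by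
  induction n with
  | zero => simp
  | succ n ih =>
    rw [Finset.sum_range_succ, Finset.sum_range_succ' (fun k => w ^ (k + 1)), mul_add,
      pow_succ w (n + 1), mul_right_comm, ih, Finset.sum_mul, inv_pow]
    simp only [← pow_succ]
    congr 1
    field_simp
    ring

theorem sum_zpow_Icc_neg (w : ℂ) (n : ℕ) :
    ∑ m ∈ Finset.Icc (-(n : ℤ)) n, w ^ m =
      1 + ∑ k ∈ Finset.range n, w ^ (k + 1) + ∑ k ∈ Finset.range n, w⁻¹ ^ (k + 1) := by
  induction n with
  | zero => simp
  | succ n ih =>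
    rw [Finset.sum_Icc_neg_succ, ih, Finset.sum_range_succ, Finset.sum_range_succ, zpow_neg, inv_pow]
    norm_cast
    ring

/-- There are `n + 1 - |m|` pairs of exponents with difference `m`. In the induction the new row and
column contribute each power `w ^ m`, `|m| ≤ n + 1`, exactly once. -/
theorem sum_pow_mul_sum_inv_pow {w : ℂ} (hw : w ≠ 0) (n : ℕ) :
    (∑ k ∈ Finset.range (n + 1), w ^ k) * ∑ k ∈ Finset.range (n + 1), w⁻¹ ^ k =
      ∑ m ∈ Finset.Icc (-(n : ℤ)) n, ((n : ℂ) + 1 - ((|m| : ℤ) : ℂ)) * w ^ m := by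
  induction n with
  | zero => simp
  | succ n ih =>
    have h1 := pow_succ_mul_sum_inv_pow hw n
    have h2 := pow_succ_mul_sum_inv_pow (inv_ne_zero hw) n
    rw [inv_inv] at h2
    have h3 : ∑ m ∈ Finset.Icc (-((n + 1 : ℕ) : ℤ)) (n + 1 : ℕ),
        (((n + 1 : ℕ) : ℂ) + 1 - ((|m| : ℤ) : ℂ)) * w ^ m =
        ∑ m ∈ Finset.Icc (-(n : ℤ)) n, ((n : ℂ) + 1 - ((|m| : ℤ) : ℂ)) * w ^ m +
          ∑ m ∈ Finset.Icc (-((n + 1 : ℕ) : ℤ)) (n + 1 : ℕ), w ^ m := by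
      have habs : |(n : ℤ) + 1| = n + 1 := abs_of_nonneg (by omega)
      rw [Finset.sum_Icc_neg_succ, Finset.sum_Icc_neg_succ, abs_neg, habs]
      have : ∀ m : ℤ, (((n + 1 : ℕ) : ℂ) + 1 - ((|m| : ℤ) : ℂ)) * w ^ m =
          ((n : ℂ) + 1 - ((|m| : ℤ) : ℂ)) * w ^ m + w ^ m := fun m => by
        push_cast
        ring
      rw [Finset.sum_congr rfl fun m _ => this m, Finset.sum_add_distrib]
      push_cast
      ring
    have hw' : w ^ (n + 1) * w⁻¹ ^ (n + 1) = 1 := by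
      rw [← mul_pow, mul_inv_cancel₀ hw, one_pow]
    rw [h3, ← ih, sum_zpow_Icc_neg, ← h1, ← h2, Finset.sum_range_succ _ (n + 1),
      Finset.sum_range_succ _ (n + 1), add_mul, mul_add, mul_add, hw']
    ring

/-- The Fejér kernel. -/
noncomputable def fejerKernel (L : ℕ) (u : ℝ) : ℂ :=
  ∑ m ∈ Finset.Icc (-(L : ℤ)) L,
    ((1 - |(m : ℝ)| / ((L : ℝ) + 1) : ℝ) : ℂ) * Complex.exp (-(Complex.I * u * m))

/-- The kernel is `|D|² / (L + 1)` for the geometric sum `D`, hence real and nonnegative. -/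
theorem fejerKernel_eq_norm (L : ℕ) (u : ℝ) : fejerKernel L u = (‖fejerKernel L u‖ : ℂ) := by
  set w : ℂ := Complex.exp (-(Complex.I * u))
  have hw : w ≠ 0 := Complex.exp_ne_zero _
  have hconj : (starRingEnd ℂ) w = w⁻¹ := by
    rw [← Complex.exp_conj, ← Complex.exp_neg]
    simp
  have hL : (L : ℂ) + 1 ≠ 0 := by exact_mod_cast L.succ_ne_zero
  set D := ∑ k ∈ Finset.range (L + 1), w ^ k
  have h : fejerKernel L u = ((Complex.normSq D / (L + 1) : ℝ) : ℂ) := by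
    have hD : (starRingEnd ℂ) D = ∑ k ∈ Finset.range (L + 1), w⁻¹ ^ k := by
      rw [map_sum]
      exact Finset.sum_congr rfl fun k _ => by rw [map_pow, hconj]
    push_cast
    rw [← Complex.mul_conj, hD, sum_pow_mul_sum_inv_pow hw, Finset.sum_div, fejerKernel]
    refine Finset.sum_congr rfl fun m _ => ?_
    have : Complex.exp (-(Complex.I * u * m)) = w ^ m := by
      rw [← Complex.exp_int_mul]
      congr 1
      ring
    have habs : ((|(m : ℝ)| : ℝ) : ℂ) = ((|m| : ℤ) : ℂ) := by
      rw [← Int.cast_abs, Complex.ofReal_intCast]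
    rw [this]
    push_cast
    rw [habs]
    field_simp
  have hnn : 0 ≤ Complex.normSq D / (L + 1) := div_nonneg (Complex.normSq_nonneg _) (by positivity)
  rw [h, Complex.norm_real, Real.norm_of_nonneg hnn]

theorem integral_exp_I_mul_int (k : ℤ) :
    ∫ u in (0 : ℝ)..(2 * Real.pi), Complex.exp (-(Complex.I * u * k)) =
      if k = 0 then ((2 * Real.pi : ℝ) : ℂ) else 0 := by
  split_ifs with hk
  · simp [hk]
  · have hc : -(Complex.I * k) ≠ 0 := neg_ne_zero.2 (mul_ne_zero Complex.I_ne_zero (by exact_mod_cast hk))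
    have h := integral_exp_mul_complex (a := 0) (b := 2 * Real.pi) hc
    have h1 : Complex.exp (-(Complex.I * k) * ((2 * Real.pi : ℝ) : ℂ)) = 1 := by
      rw [Complex.exp_eq_one_iff]
      exact ⟨-k, by push_cast; ring⟩
    rw [h1, Complex.ofReal_zero, mul_zero, Complex.exp_zero, sub_self, zero_div] at h
    rw [← h]
    congr 1
    funext u
    congr 1
    ring

/-- By positivity the norm may be dropped, and only the constant term survives integration. -/
theorem integral_norm_fejerKernel (L : ℕ) :
    ∫ u in (0 : ℝ)..(2 * Real.pi), ‖fejerKernel L u‖ = 2 * Real.pi := by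
  have h : ∫ u in (0 : ℝ)..(2 * Real.pi), fejerKernel L u = ((2 * Real.pi : ℝ) : ℂ) := by
    unfold fejerKernel
    rw [intervalIntegral.integral_finsetSum fun m _ => Continuous.intervalIntegrable (by fun_prop) _ _]
    simp only [intervalIntegral.integral_const_mul, integral_exp_I_mul_int, mul_ite, mul_zero]
    rw [Finset.sum_ite_eq', if_pos (by simp)]
    simp
  rw [funext (fejerKernel_eq_norm L), intervalIntegral.integral_ofReal] at h
  exact_mod_cast h

theorem sum_smul_smul_integral {ι E : Type*} [NormedAddCommGroup E] [NormedSpace ℂ E]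
    (t : Finset ι) (c : ι → ℂ) (a : ℂ) {g : ι → ℝ → E} (hg : ∀ i, Continuous (g i)) {x y : ℝ} :
    ∑ i ∈ t, c i • a • ∫ u in x..y, g i u = a • ∫ u in x..y, ∑ i ∈ t, c i • g i u := by
  have hint : ∀ i ∈ t, IntervalIntegrable (fun u => c i • g i u) volume x y := fun i _ =>
    ((hg i).const_smul (c i)).intervalIntegrable _ _
  rw [intervalIntegral.integral_finsetSum hint, Finset.smul_sum]
  refine Finset.sum_congr rfl fun i _ => ?_
  rw [intervalIntegral.integral_smul, smul_comm]

namespace BosonField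

variable {s : ℕ}

/-! ### Harmonic analysis -/

theorem continuous_harmonic_integrand (m : ℤ) {F : Op s}
    (hF : Continuous fun z : Circle => gauge s z F) :
    Continuous fun u : ℝ => Complex.exp (-(Complex.I * u * m)) • gauge s (Circle.exp u) F :=
  (by fun_prop : Continuous fun u : ℝ => Complex.exp (-(Complex.I * u * m))).smul
    (hF.comp Circle.exp.continuous)

theorem norm_exp_neg_I_mul (u : ℝ) (m : ℤ) : ‖Complex.exp (-(Complex.I * u * m))‖ = 1 := by
  have : -(Complex.I * u * m) = ((-(u * m) : ℝ) : ℂ) * Complex.I := by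
    push_cast
    ring
  rw [this, Complex.norm_exp_ofReal_mul_I]

theorem norm_harmonic_le (m : ℤ) (F : Op s) : ‖harmonic m F‖ ≤ ‖F‖ := by
  have h2pi := Real.two_pi_pos
  have h := intervalIntegral.norm_integral_le_of_norm_le_const (a := 0) (b := 2 * Real.pi) (C := ‖F‖)
    (f := fun u : ℝ => Complex.exp (-(Complex.I * u * m)) • gauge s (Circle.exp u) F)
    fun u _ => by rw [norm_smul, norm_exp_neg_I_mul, one_mul, norm_gauge]
  rw [sub_zero, abs_of_pos h2pi] at h
  rw [harmonic, norm_smul, norm_inv, Complex.norm_real, Real.norm_of_nonneg h2pi.le,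
    inv_mul_le_iff₀ h2pi, mul_comm _ ‖F‖]
  exact h

theorem harmonic_sub (m : ℤ) {F G : Op s} (hF : Continuous fun z : Circle => gauge s z F)
    (hG : Continuous fun z : Circle => gauge s z G) :
    harmonic m (F - G) = harmonic m F - harmonic m G := by
  rw [harmonic, harmonic, harmonic, ← smul_sub, ← intervalIntegral.integral_sub
    ((continuous_harmonic_integrand m hF).intervalIntegrable _ _)
    ((continuous_harmonic_integrand m hG).intervalIntegrable _ _)]
  simp only [map_sub, smul_sub]

/-- Additivity of the integral is only available for continuous orbits, hence continuity merely on
the extended field algebra. -/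
theorem continuousOn_harmonic (m : ℤ) :
    ContinuousOn (harmonic m : Op s → Op s) (extendedFieldAlgebra s) := by
  refine LipschitzOnWith.continuousOn (K := 1) (LipschitzOnWith.of_dist_le_mul fun F hF G hG => ?_)
  rw [dist_eq_norm, dist_eq_norm, ← harmonic_sub m (continuous_orbit_of_mem_extendedFieldAlgebra hF)
    (continuous_orbit_of_mem_extendedFieldAlgebra hG), NNReal.coe_one, one_mul]
  exact norm_harmonic_le m _

theorem harmonic_sum (m : ℤ) {ι : Type*} (t : Finset ι) (F : ι → Op s)
    (hF : ∀ i ∈ t, Continuous fun z : Circle => gauge s z (F i)) :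
    harmonic m (∑ i ∈ t, F i) = ∑ i ∈ t, harmonic m (F i) := by
  simp only [harmonic]
  rw [← Finset.smul_sum, ← intervalIntegral.integral_finsetSum fun i hi =>
    (continuous_harmonic_integrand m (hF i hi)).intervalIntegrable _ _]
  simp only [map_sum, Finset.smul_sum]

theorem IsTensor.harmonic_eq {k : ℤ} {B : Op s} (hB : IsTensor k B) (m : ℤ) :
    harmonic m B = if m = k then B else 0 := by
  have hint : (fun u : ℝ => Complex.exp (-(Complex.I * u * m)) • gauge s (Circle.exp u) B) =
      fun u : ℝ => Complex.exp (-(Complex.I * u * (m - k : ℤ))) • B := by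
    funext u
    rw [hB, smul_smul, Circle.coe_exp, ← Complex.exp_int_mul, ← Complex.exp_add]
    congr 2
    push_cast
    ring
  rw [harmonic, hint, intervalIntegral.integral_smul_const, integral_exp_I_mul_int]
  simp only [sub_eq_zero]
  have h2pi : ((2 * Real.pi : ℝ) : ℂ) ≠ 0 := by exact_mod_cast Real.two_pi_pos.ne'
  split_ifs
  · exact inv_smul_smul₀ h2pi B
  · rw [zero_smul, smul_zero]

/-- Integral and discrete mean both select the tensor of degree `m` from the finite decomposition of
`F`. -/
theorem harmonic_of_mem_localFields {M : ℕ} {F : Op s} (hF : F ∈ localFields s M) (m : ℤ) :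
    harmonic m F = if |m| ≤ M then bandProjection s M m F else 0 := by
  have hT : ∀ k ∈ Finset.Icc (-(M : ℤ)) M, IsTensor k (bandProjection s M k F) := fun k hk =>
    isTensor_bandProjection (abs_le.2 (Finset.mem_Icc.1 hk)) hF
  conv_lhs => rw [← sum_bandProjection_of_mem_localFields hF]
  rw [harmonic_sum m _ _ fun k hk => (hT k hk).continuous_orbit,
    Finset.sum_congr rfl fun k hk => (hT k hk).harmonic_eq m, Finset.sum_ite_eq]
  simp only [Finset.mem_Icc, abs_le]

theorem harmonic_mem_extendedFieldAlgebra (m : ℤ) {F : Op s} (hF : F ∈ extendedFieldAlgebra s) :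
    harmonic m F ∈ extendedFieldAlgebra s := by
  refine Set.MapsTo.closure_of_continuousOn (fun G hG => ?_) (continuousOn_harmonic m) hF
  obtain ⟨M, hG⟩ := Set.mem_iUnion.1 hG
  rw [harmonic_of_mem_localFields hG]
  refine Set.mem_iUnion.2 ⟨M, ?_⟩
  split_ifs with h
  · exact bandProjection_mem_localFields h hG
  · exact zero_mem_localFields M

theorem isTensor_harmonic (m : ℤ) {F : Op s} (hF : F ∈ extendedFieldAlgebra s) :
    IsTensor m (harmonic m F) := by
  refine (isClosed_tensors m).closure_subset (Set.MapsTo.closure_of_continuousOn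
    (t := (tensors s m : Set (Op s))) (fun G hG => ?_) (continuousOn_harmonic m) hF)
  obtain ⟨M, hG⟩ := Set.mem_iUnion.1 hG
  rw [harmonic_of_mem_localFields hG]
  split_ifs with h
  · exact isTensor_bandProjection h hG
  · exact zero_mem _

theorem sum_harmonic_of_mem_localFields {M : ℕ} {F : Op s} (hF : F ∈ localFields s M) :
    ∑ m ∈ Finset.Icc (-(M : ℤ)) M, harmonic m F = F := by
  conv_rhs => rw [← sum_bandProjection_of_mem_localFields hF]
  refine Finset.sum_congr rfl fun m hm => ?_
  rw [harmonic_of_mem_localFields hF, if_pos (abs_le.2 (Finset.mem_Icc.1 hm))]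

theorem extendedObservables_eq_fixedPoints :
    extendedObservables s = {F | F ∈ extendedFieldAlgebra s ∧ ∀ z : Circle, gauge s z F = F} := by
  refine Set.Subset.antisymm (fun A hA => ⟨localFields_subset_extendedFieldAlgebra 0
    (extendedObservables_subset_localFields hA), gauge_of_mem_extendedObservables hA⟩) ?_
  rintro F ⟨hF, hinv⟩
  have h0 : harmonic 0 F = F := by
    rw [(isTensor_zero_iff.2 hinv).harmonic_eq 0, if_pos rfl]
  -- As a zeroth harmonic, `F` is approximated by zeroth harmonics of local fields, which are
  -- extended observables.
  rw [← h0]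
  refine isClosed_extendedObservables.closure_subset (Set.MapsTo.closure_of_continuousOn
    (fun G hG => ?_) (continuousOn_harmonic 0) hF)
  obtain ⟨M, hG⟩ := Set.mem_iUnion.1 hG
  rw [harmonic_of_mem_localFields hG, if_pos (by simp)]
  exact bandProjection_zero_mem_extendedObservables hG

/-! ### Harmonic synthesis -/

/-- The Cesàro sums of the harmonics. -/
noncomputable def cesaro (L : ℕ) (F : Op s) : Op s :=
  ∑ m ∈ Finset.Icc (-(L : ℤ)) L, ((1 - |(m : ℝ)| / ((L : ℝ) + 1) : ℝ) : ℂ) • harmonic m F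

theorem cesaro_eq_integral (L : ℕ) {F : Op s} (hF : Continuous fun z : Circle => gauge s z F) :
    cesaro L F = ((2 * Real.pi : ℝ) : ℂ)⁻¹ •
      ∫ u in (0 : ℝ)..(2 * Real.pi), fejerKernel L u • gauge s (Circle.exp u) F := by
  simp only [cesaro, harmonic, fejerKernel, Finset.sum_smul, mul_smul]
  exact sum_smul_smul_integral _ _ _ fun m => continuous_harmonic_integrand m hF

theorem norm_cesaro_le (L : ℕ) {F : Op s} (hF : Continuous fun z : Circle => gauge s z F) :
    ‖cesaro L F‖ ≤ ‖F‖ := by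
  have h2pi := Real.two_pi_pos
  have h := intervalIntegral.norm_integral_le_integral_norm (μ := volume) h2pi.le
    (f := fun u : ℝ => fejerKernel L u • gauge s (Circle.exp u) F)
  simp only [norm_smul, norm_gauge] at h
  rw [intervalIntegral.integral_mul_const, integral_norm_fejerKernel] at h
  rw [cesaro_eq_integral L hF, norm_smul, norm_inv, Complex.norm_real, Real.norm_of_nonneg h2pi.le,
    inv_mul_le_iff₀ h2pi]
  exact h

theorem cesaro_sub (L : ℕ) {F G : Op s} (hF : Continuous fun z : Circle => gauge s z F)
    (hG : Continuous fun z : Circle => gauge s z G) :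
    cesaro L (F - G) = cesaro L F - cesaro L G := by
  simp only [cesaro, harmonic_sub _ hF hG, smul_sub, Finset.sum_sub_distrib]

theorem tendsto_cesaro_of_mem_localFields {M : ℕ} {F : Op s} (hF : F ∈ localFields s M) :
    Filter.Tendsto (fun L => cesaro L F) Filter.atTop (nhds F) := by
  have hlim : Filter.Tendsto (fun L : ℕ => ∑ m ∈ Finset.Icc (-(M : ℤ)) M,
      ((1 - |(m : ℝ)| / ((L : ℝ) + 1) : ℝ) : ℂ) • harmonic m F) Filter.atTop
      (nhds (∑ m ∈ Finset.Icc (-(M : ℤ)) M, ((1 - 0 : ℝ) : ℂ) • harmonic m F)) := by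
    refine tendsto_finsetSum _ fun m _ => Filter.Tendsto.smul_const ?_ _
    refine (Complex.continuous_ofReal.tendsto _).comp (tendsto_const_nhds.sub ?_)
    exact tendsto_const_nhds.div_atTop
      (Filter.tendsto_atTop_add_const_right _ _ tendsto_natCast_atTop_atTop)
  simp only [sub_zero, Complex.ofReal_one, one_smul, sum_harmonic_of_mem_localFields hF] at hlim
  -- For `L ≥ M` the additional harmonics vanish, so only the weights depend on `L`.
  refine hlim.congr' ?_
  filter_upwards [Filter.eventually_ge_atTop M] with L hL
  refine Finset.sum_subset (Finset.Icc_subset_Icc (by omega) (by omega)) fun m _ hm => ?_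
  rw [harmonic_of_mem_localFields hF, if_neg, smul_zero]
  rwa [abs_le, ← Finset.mem_Icc]

theorem tendsto_cesaro {F : Op s} (hF : F ∈ extendedFieldAlgebra s) :
    Filter.Tendsto (fun L => cesaro L F) Filter.atTop (nhds F) := by
  rw [Metric.tendsto_atTop]
  intro ε hε
  obtain ⟨G, hG, hFG⟩ := Metric.mem_closure_iff.1 hF (ε / 3) (by positivity)
  obtain ⟨M, hG⟩ := Set.mem_iUnion.1 hG
  obtain ⟨N, hN⟩ := Metric.tendsto_atTop.1 (tendsto_cesaro_of_mem_localFields hG) (ε / 3)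
    (by positivity)
  refine ⟨N, fun L hL => ?_⟩
  have hFc := continuous_orbit_of_mem_extendedFieldAlgebra hF
  have hGc := continuous_orbit_of_mem_localFields hG
  have h1 : dist (cesaro L F) (cesaro L G) ≤ dist F G := by
    rw [dist_eq_norm, dist_eq_norm, ← cesaro_sub L hFc hGc]
    refine norm_cesaro_le L ?_
    simp only [map_sub]
    exact hFc.sub hGc
  have h2 := dist_triangle4 (cesaro L F) (cesaro L G) G F
  have h3 := hN L hL
  rw [dist_comm G F] at h2
  linarith

end BosonField

theorem lemma3p2 (s : ℕ) :
    -- the extended field algebra is a C*-algebra, i.e. a norm closed *-subalgebra of `B(𝓕)`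
    (∃ 𝔉 : StarSubalgebra ℂ (Op s),
      (𝔉 : Set (Op s)) = extendedFieldAlgebra s ∧ IsClosed (𝔉 : Set (Op s))) ∧
    -- it contains the field algebra and the extended algebra of observables
    fieldAlgebra s ⊆ extendedFieldAlgebra s ∧
    extendedObservables s ⊆ extendedFieldAlgebra s ∧
    -- the gauge group acts on it by automorphisms, pointwise norm continuously
    (∀ z : Circle, gauge s z '' extendedFieldAlgebra s = extendedFieldAlgebra s) ∧
    (∀ F ∈ extendedFieldAlgebra s, Continuous fun z : Circle => gauge s z F) ∧
    -- harmonic analysis: the harmonics, defined by norm convergent integrals, are tensors in it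
    (∀ F ∈ extendedFieldAlgebra s, ∀ m : ℤ,
      IntervalIntegrable
        (fun u : ℝ => Complex.exp (-(Complex.I * u * m)) • gauge s (Circle.exp u) F)
        MeasureTheory.volume 0 (2 * Real.pi) ∧
      harmonic m F ∈ extendedFieldAlgebra s ∧ IsTensor m (harmonic m F)) ∧
    -- harmonic synthesis: a finite sum on the dense set of operators which define the algebra,
    -- and norm convergent Cesàro means of the harmonics on the whole algebra
    (∀ M : ℕ, ∀ F ∈ localFields s M,
      (∀ m : ℤ, (harmonic m F ∈ localFields s M) ∧ ((M : ℤ) < |m| → harmonic m F = 0)) ∧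
      F = ∑ m ∈ Finset.Icc (-(M : ℤ)) M, harmonic m F) ∧
    (∀ F ∈ extendedFieldAlgebra s,
      Filter.Tendsto
        (fun L : ℕ => ∑ m ∈ Finset.Icc (-(L : ℤ)) L,
          ((1 - |(m : ℝ)| / ((L : ℝ) + 1) : ℝ) : ℂ) • harmonic m F)
        Filter.atTop (nhds F)) ∧
    -- the extended algebra of observables is the fixed point algebra under gauge transformations
    extendedObservables s = {F | F ∈ extendedFieldAlgebra s ∧ ∀ z : Circle, gauge s z F = F} := by
  refine ⟨⟨(localFieldAlgebra s).topologicalClosure,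
    StarSubalgebra.topologicalClosure_coe _, StarSubalgebra.isClosed_topologicalClosure _⟩,
    closure_mono (Set.iUnion_mono tensorSpace_subset_localFields),
    extendedObservables_subset_localFields.trans (localFields_subset_extendedFieldAlgebra 0),
    image_gauge_extendedFieldAlgebra, fun F hF => continuous_orbit_of_mem_extendedFieldAlgebra hF,
    fun F hF m => ⟨(continuous_harmonic_integrand m
      (continuous_orbit_of_mem_extendedFieldAlgebra hF)).intervalIntegrable _ _,
      harmonic_mem_extendedFieldAlgebra m hF, isTensor_harmonic m hF⟩,
    fun M F hF => ⟨fun m => ⟨?_, fun hm => ?_⟩, (sum_harmonic_of_mem_localFields hF).symm⟩,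
    fun F hF => tendsto_cesaro hF, extendedObservables_eq_fixedPoints⟩
  · rw [harmonic_of_mem_localFields hF]
    split_ifs with h
    · exact bandProjection_mem_localFields h hF
    · exact zero_mem_localFields M
  · rw [harmonic_of_mem_localFields hF, if_neg hm.not_ge]
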